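/- Let $N\in\mathbb N$, let $p^N(x)=(2\pi)^{-N/2}e^{-|x|^2/2}$ be the density of the standard Gaussian measure $\mu^N$ on $\mathbb R^N$, and let $$L=-\sum_{i=1}^N\frac{\partial^2}{\partial x_i^2}+\sum_{i=1}^N x_i\frac{\partial}{\partial x_i}$$ be the Ornstein–Uhlenbeck operator, a nonnegative self-adjoint operator in $L^2(\mu^N)$. Functions and distributions are real-valued or complex-valued. For $s\in\mathbb R$ let $\mathbb D^{(N)}_{2,s}$ be the completion of $\{f\in L^2(\mu^N):\|f\|_{2,s}<\infty\}$ for the norm $$\|f\|_{2,s}=\|(1+L)^{s/2}f\|_{L^2(\mu^N)},$$ regarded as a space of distributions on $\mathbb R^N$: its elements are the limits, in the sense of distributions, of $\|\cdot\|_{2,s}$-Cauchy sequences of such $f$, a function $f$ being identified with the distribution $\varphi\mapsto\int f\varphi\,dx$. Put $$\mathbb D^{(N)}_{2,\infty}=\bigcap_{s>0}\mathbb D^{(N)}_{2,s},\qquad \mathbb D^{(N)}_{2,-\infty}=\bigcup_{s<0}\mathbb D^{(N)}_{2,s}.$$ Let $\mathcal S$ be the Schwartz space on $\mathbb R^N$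 and $\mathcal S'$ its topological dual, the space of tempered distributions. Then for every distribution $X$ on $\mathbb R^N$, $$X\,(p^N)^{1/2}\in\mathcal S\iff X\in\mathbb D^{(N)}_{2,\infty},$$ $$X\,(p^N)^{1/2}\in\mathcal S'\iff X\in\mathbb D^{(N)}_{2,-\infty}.$$ -/

import Mathlib

open MeasureTheory Filter Topology
open scoped Distributions SchwartzMap ContDiff

noncomputable section

namespace DiscreteWiener

/-- The Euclidean space `ℝ^N`. -/
abbrev Space (N : ℕ) : Type := EuclideanSpace ℝ (Fin N)

/-- `C_c^∞(ℝ^N; ℝ)`. -/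
abbrev Test (N : ℕ) : Type := 𝓓((⊤ : TopologicalSpace.Opens (Space N)), ℝ)

/-- The `𝕜`-valued distributions on `ℝ^N` (with `𝕜 = ℝ` or `ℂ`): the largest space of objects `X`
that can be multiplied by the smooth positive function `(p^N)^{1/2}`. A locally integrable function
`f` is identified with the distribution `φ ↦ ∫ φ f dx` (Lebesgue measure). -/
abbrev Distr (N : ℕ) (𝕜 : Type*) [RCLike 𝕜] : Type _ :=
  𝓓'((⊤ : TopologicalSpace.Opens (Space N)), 𝕜)

/-- The density `p^N(x) = (2π)^{-N/2} exp(-|x|²/2)`. -/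
def density (N : ℕ) (x : Space N) : ℝ :=
  (2 * Real.pi) ^ (-(N : ℝ) / 2) * Real.exp (-‖x‖ ^ 2 / 2)

/-- The standard Gaussian measure `μ^N` on `ℝ^N`. -/
def gaussian (N : ℕ) : Measure (Space N) :=
  (volume : Measure (Space N)).withDensity (fun x => ENNReal.ofReal (density N x))

/-- `L²(μ^N)` with values in `𝕜`. -/
abbrev L2 (N : ℕ) (𝕜 : Type*) [RCLike 𝕜] : Type _ := Lp 𝕜 2 (gaussian N)

lemma density_pos (N : ℕ) (x : Space N) : 0 < density N x := by
  unfold density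
  positivity

lemma contDiff_density (N : ℕ) : ContDiff ℝ ∞ (density N) := by
  unfold density
  exact contDiff_const.mul (((contDiff_norm_sq ℝ).neg.div_const 2).exp)

lemma contDiff_sqrt_density (N : ℕ) : ContDiff ℝ ∞ (fun x => Real.sqrt (density N x)) :=
  (contDiff_density N).sqrt (fun x => (density_pos N x).ne')

/-- Multiplication `φ ↦ (p^N)^{1/2} φ` of test functions. -/
def mulSqrtTest (N : ℕ) : Test N →ₗ[ℝ] Test N where
  toFun φ :=
    { toFun := fun x => Real.sqrt (density N x) * φ x
      contDiff' := (contDiff_sqrt_density N).mul φ.contDiff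
      hasCompactSupport' := φ.hasCompactSupport.mul_left
      tsupport_subset' := fun _ _ => trivial }
  map_add' φ ψ := by
    ext x
    exact mul_add _ _ _
  map_smul' c φ := by
    ext x
    exact mul_left_comm _ _ _

/-- The product `X (p^N)^{1/2}` of a distribution and a smooth function:
`⟨X (p^N)^{1/2}, φ⟩ = ⟨X, (p^N)^{1/2} φ⟩`. -/
def mulSqrt {N : ℕ} {𝕜 : Type*} [RCLike 𝕜] (X : Distr N 𝕜) : Test N →ₗ[ℝ] 𝕜 :=
  (X : Test N →ₗ[ℝ] 𝕜) ∘ₗ mulSqrtTest N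

/-- A test function as a `𝕜`-valued Schwartz function. -/
def testToSchwartz {N : ℕ} (𝕜 : Type*) [RCLike 𝕜] (φ : Test N) : 𝓢(Space N, 𝕜) :=
  HasCompactSupport.toSchwartzMap (f := fun x => ((φ x : ℝ) : 𝕜))
    (φ.hasCompactSupport.comp_left (g := fun r : ℝ => (r : 𝕜)) (by simp))
    ((RCLike.ofRealCLM (K := 𝕜)).contDiff.comp φ.contDiff)

/-- The functional `T` on test functions is (given by) a Schwartz function. -/
def IsSchwartz {N : ℕ} {𝕜 : Type*} [RCLike 𝕜] (T : Test N →ₗ[ℝ] 𝕜) : Prop :=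
  ∃ ψ : 𝓢(Space N, 𝕜), ∀ φ : Test N, T φ = ∫ x, φ x • ψ x

/-- The functional `T` on test functions is (the restriction of) a tempered distribution, i.e. of an
element of the topological dual of the Schwartz space. -/
def IsTempered {N : ℕ} {𝕜 : Type*} [RCLike 𝕜] (T : Test N →ₗ[ℝ] 𝕜) : Prop :=
  ∃ U : 𝓢(Space N, 𝕜) →L[𝕜] 𝕜, ∀ φ : Test N, T φ = U (testToSchwartz 𝕜 φ)

/-- The partial derivative `∂φ/∂x_i`. -/
def partialDeriv {N : ℕ} (i : Fin N) (φ : Space N → ℝ) (x : Space N) : ℝ :=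
  fderiv ℝ φ x (EuclideanSpace.single i 1)

/-- The Ornstein–Uhlenbeck differential operator `L = -∑ ∂²/∂x_i² + ∑ x_i ∂/∂x_i`. -/
def ornsteinUhlenbeck {N : ℕ} (φ : Space N → ℝ) (x : Space N) : ℝ :=
  -∑ i, partialDeriv i (partialDeriv i φ) x + ∑ i, x i * partialDeriv i φ x

/-- `f` lies in the domain of the self-adjoint realization of `L` in `L²(μ^N)`, and `L f = g`.
The operator `L` on `C_c^∞` is symmetric and essentially self-adjoint in `L²(μ^N)`; its unique
self-adjoint extension is its adjoint, that is, `L` in the sense of distributions. -/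
def IsOU {N : ℕ} {𝕜 : Type*} [RCLike 𝕜] (f g : L2 N 𝕜) : Prop :=
  ∀ φ : Test N, ∫ x, ornsteinUhlenbeck φ x • f x ∂(gaussian N) = ∫ x, φ x • g x ∂(gaussian N)

/-- `f` lies in the domain of `(1 + L)^{s/2}`, and `(1 + L)^{s/2} f = g`, by the spectral calculus of
the nonnegative self-adjoint operator `L`, whose spectrum is pure point: for every eigenvalue `r`,
the components of `f` and `g` in the eigenspace of `r` satisfy `J_r g = (1 + r)^{s/2} J_r f`. -/
def IsOUPower {N : ℕ} {𝕜 : Type*} [RCLike 𝕜] (s : ℝ) (f g : L2 N 𝕜) : Prop :=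
  ∀ (r : ℝ) (h : L2 N 𝕜), IsOU h ((r : 𝕜) • h) →
    inner 𝕜 h g = (((1 + r) ^ (s / 2) : ℝ) : 𝕜) * inner 𝕜 h f

/-- The Sobolev space `𝔻_{2,s}`: the completion of
`{f ∈ L²(μ^N) : ‖f‖_{2,s} < ∞}` for the norm `‖f‖_{2,s} = ‖(1 + L)^{s/2} f‖_{L²(μ^N)}`, realized
in the space of distributions. Its elements are the limits `X`, in the sense of distributions, of the
sequences `f n` that are Cauchy for `‖·‖_{2,s}`; here `g n = (1 + L)^{s/2} (f n)`, so
`‖f n - f m‖_{2,s} = ‖g n - g m‖`. -/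
def sobolev (N : ℕ) (𝕜 : Type*) [RCLike 𝕜] (s : ℝ) : Set (Distr N 𝕜) :=
  {X | ∃ f g : ℕ → L2 N 𝕜, (∀ n, IsOUPower s (f n) (g n)) ∧ CauchySeq g ∧
    ∀ φ : Test N, Tendsto (fun n => ∫ x, φ x • f n x) atTop (𝓝 (X φ))}

/-- `𝔻_{2,∞} = ⋂_{s > 0} 𝔻_{2,s}`. -/
def sobolevTop (N : ℕ) (𝕜 : Type*) [RCLike 𝕜] : Set (Distr N 𝕜) :=
  ⋂ (s : ℝ) (_ : 0 < s), sobolev N 𝕜 s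

/-- `𝔻_{2,-∞} = ⋃_{s < 0} 𝔻_{2,s}`. -/
def sobolevBot (N : ℕ) (𝕜 : Type*) [RCLike 𝕜] : Set (Distr N 𝕜) :=
  ⋃ (s : ℝ) (_ : s < 0), sobolev N 𝕜 s

end DiscreteWiener

end

noncomputable section

namespace DiscreteWiener

/-!
Multiplication by `(p^N)^{1/2}` is an isometry of `L²(μ^N)` onto `L²(dx)` which carries `L` to the
number operator `H = ∑ aᵢ† aᵢ`, with `aᵢ = ∂/∂xᵢ + xᵢ/2` and `aᵢ† = -∂/∂xᵢ + xᵢ/2`. The commutation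
relations make the Hermite functions of degree `n` eigenvectors of `H` with eigenvalue `n`, and they
are total in `L²(dx)`: a function orthogonal to every polynomial times the Gaussian `(p^N)^{1/2}`
has a product with that Gaussian whose Fourier transform vanishes.

Both equivalences rest on one estimate: each Schwartz seminorm, restricted to the Hermite functions
of degree `n`, is at most a polynomial in `n` times the `L²` norm. It follows from the Sobolev
embedding, since `xᵢ` and `∂/∂xᵢ` are combinations of `aᵢ` and `aᵢ†`. Hence the Schwartz functions
are the Hermite expansions with rapidly decreasing components, and the tempered distributions those
with components of polynomial growth, while `(1 + L)^{s/2}` multiplies the component of degree `n`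
by `(1 + n)^{s/2}`.
-/

section Schwartz

open SchwartzMap LineDeriv

variable {ι E F : Type*} [NormedAddCommGroup E] [NormedAddCommGroup F]

lemma norm_le_sum_norm_apply_orthonormalBasis {𝕜 : Type*} [RCLike 𝕜] [InnerProductSpace 𝕜 E]
    [NormedSpace 𝕜 F] [Fintype ι] (b : OrthonormalBasis ι 𝕜 E) {n : ℕ}
    (T : ContinuousMultilinearMap 𝕜 (fun _ : Fin n => E) F) :
    ‖T‖ ≤ ∑ I : Fin n → ι, ‖T fun j => b (I j)‖ := by
  classical
  refine T.opNorm_le_bound (by positivity) fun v => ?_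
  have hexpand : T v = ∑ I : Fin n → ι, T fun j => b.repr (v j) (I j) • b (I j) := by
    rw [← T.map_sum fun j i => b.repr (v j) i • b i]
    simp only [b.sum_repr]
  rw [hexpand, Finset.sum_mul]
  refine (norm_sum_le _ _).trans (Finset.sum_le_sum fun I _ => ?_)
  rw [T.map_smul_univ, norm_smul, mul_comm, norm_prod]
  gcongr with j
  exact (PiLp.norm_apply_le _ _).trans_eq (b.repr.norm_map _)

lemma seminorm_le_sum_lineDeriv {𝕜 : Type*} [RCLike 𝕜] [InnerProductSpace ℝ E]
    [NormedSpace ℝ F] [NormedSpace 𝕜 F] [SMulCommClass ℝ 𝕜 F] [Fintype ι]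
    (b : OrthonormalBasis ι ℝ E) (k n : ℕ) (ψ : 𝓢(E, F)) :
    SchwartzMap.seminorm 𝕜 k n ψ ≤ ∑ I : Fin n → ι,
      (SchwartzMap.seminorm 𝕜 0 0 (∂^{fun j => b (I j)} ψ) +
        SchwartzMap.seminorm 𝕜 0 0
          (smulLeftCLM F (fun x : E => (‖x‖ ^ 2) ^ k) (∂^{fun j => b (I j)} ψ))) := by
  refine SchwartzMap.seminorm_le_bound 𝕜 k n ψ (by positivity) fun x => ?_
  refine (mul_le_mul_of_nonneg_left (norm_le_sum_norm_apply_orthonormalBasis b _)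
    (by positivity)).trans ?_
  rw [Finset.mul_sum]
  refine Finset.sum_le_sum fun I _ => ?_
  rw [← iteratedLineDerivOp_eq_iteratedFDeriv]
  set φ := ∂^{fun j => b (I j)} ψ
  have hweight := SchwartzMap.norm_le_seminorm 𝕜 (smulLeftCLM F (fun x : E => (‖x‖ ^ 2) ^ k) φ) x
  rw [smulLeftCLM_apply_apply (g := fun x : E => (‖x‖ ^ 2) ^ k)
    ((Function.hasTemperateGrowth_norm_sq E).pow k), norm_smul,
      Real.norm_of_nonneg (by positivity)] at hweight
  have hpow : ‖x‖ ^ k ≤ 1 + (‖x‖ ^ 2) ^ k := by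
    nlinarith [sq_nonneg (‖x‖ ^ k - 1), sq_nonneg (‖x‖ ^ k), pow_right_comm ‖x‖ 2 k,
      pow_nonneg (norm_nonneg x) k]
  calc ‖x‖ ^ k * ‖φ x‖ ≤ (1 + (‖x‖ ^ 2) ^ k) * ‖φ x‖ := by gcongr
    _ ≤ _ := by linarith [SchwartzMap.norm_le_seminorm 𝕜 φ x]

variable [NormedSpace ℝ F]

section Series

variable [NormedSpace ℝ E] [CompleteSpace F]

lemma exists_eq_tsum_of_summable_seminorm (f : ι → 𝓢(E, F))
    (hf : ∀ k n, Summable fun j => SchwartzMap.seminorm ℝ k n (f j)) :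
    ∃ ψ : 𝓢(E, F), (∀ x, HasSum (fun j => f j x) (ψ x)) ∧
      ∀ k n, SchwartzMap.seminorm ℝ k n ψ ≤ ∑' j, SchwartzMap.seminorm ℝ k n (f j) := by
  have hsmooth : ∀ j, ContDiff ℝ ((⊤ : ℕ∞) : WithTop ℕ∞) (f j) := fun j => (f j).smooth ⊤
  have hbound : ∀ (n : ℕ) (j : ι) (x : E), (n : ℕ∞) ≤ ⊤ →
      ‖iteratedFDeriv ℝ n (f j) x‖ ≤ SchwartzMap.seminorm ℝ 0 n (f j) :=
    fun n j x _ => norm_iteratedFDeriv_le_seminorm ℝ (f j) n x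
  have hdecay : ∀ k n x, ‖x‖ ^ k * ‖iteratedFDeriv ℝ n (fun y => ∑' j, f j y) x‖ ≤
      ∑' j, SchwartzMap.seminorm ℝ k n (f j) := by
    intro k n x
    have hsum : Summable fun j => ‖iteratedFDeriv ℝ n (f j) x‖ :=
      .of_nonneg_of_le (fun j => norm_nonneg _) (fun j => hbound n j x le_top) (hf 0 n)
    rw [iteratedFDeriv_tsum_apply hsmooth (fun n _ => hf 0 n) hbound le_top x]
    calc ‖x‖ ^ k * ‖∑' j, iteratedFDeriv ℝ n (f j) x‖
        ≤ ‖x‖ ^ k * ∑' j, ‖iteratedFDeriv ℝ n (f j) x‖ := by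
          gcongr
          exact norm_tsum_le_tsum_norm hsum
      _ = ∑' j, ‖x‖ ^ k * ‖iteratedFDeriv ℝ n (f j) x‖ := tsum_mul_left.symm
      _ ≤ _ := (hsum.mul_left _).tsum_le_tsum (fun j => le_seminorm ℝ k n (f j) x) (hf k n)
  let ψ : 𝓢(E, F) :=
    { toFun := fun y => ∑' j, f j y
      smooth' := contDiff_tsum hsmooth (fun n _ => hf 0 n) hbound
      decay' := fun k n => ⟨_, hdecay k n⟩ }
  exact ⟨ψ, fun x => (Summable.of_norm_bounded (hf 0 0)
      fun j => norm_le_seminorm ℝ (f j) x).hasSum,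
    fun k n => seminorm_le_bound ℝ k n ψ (tsum_nonneg fun j => apply_nonneg _ _) (hdecay k n)⟩

lemma exists_hasSum_of_summable_seminorm (f : ι → 𝓢(E, F))
    (hf : ∀ k n, Summable fun j => SchwartzMap.seminorm ℝ k n (f j)) :
    ∃ ψ : 𝓢(E, F), HasSum f ψ := by
  obtain ⟨ψ, hψ, -⟩ := exists_eq_tsum_of_summable_seminorm f hf
  refine ⟨ψ, ?_⟩
  rw [HasSum, (schwartz_withSeminorms ℝ E F).tendsto_nhds]
  rintro ⟨k, n⟩ ε hε
  have htail := tendsto_tsum_compl_atTop_zero fun j => SchwartzMap.seminorm ℝ k n (f j)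
  filter_upwards [htail.eventually (gt_mem_nhds hε)] with s hs
  obtain ⟨ρ, hρ, hρ_le⟩ := exists_eq_tsum_of_summable_seminorm
    (fun j : {j // j ∉ s} => f j) fun k n => (hf k n).subtype _
  have hrest : ∑ j ∈ s, f j - ψ = -ρ := by
    ext x
    have hsplit := (hψ x).unique ((s.hasSum_compl_iff (a := ρ x)).1 (hρ x))
    simp [hsplit]
  rw [hrest, map_neg_eq_map]
  exact (hρ_le k n).trans_lt hs

end Series

section Density

lemma norm_pow_mul_norm_iteratedFDeriv_smul_le [NormedSpace ℝ E] {g : E → ℝ}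
    (hg : ContDiff ℝ ∞ g) {C : ℕ → ℝ}
    (hC : ∀ i x, ‖iteratedFDeriv ℝ i g x‖ ≤ C i * (1 + ‖x‖)) (ψ : 𝓢(E, F)) (k n : ℕ) (x : E) :
    ‖x‖ ^ k * ‖iteratedFDeriv ℝ n (fun y => g y • ψ y) x‖ ≤
      ∑ i ∈ Finset.range (n + 1), n.choose i * C i *
        (SchwartzMap.seminorm ℝ k (n - i) ψ + SchwartzMap.seminorm ℝ (k + 1) (n - i) ψ) := by
  have hC_nonneg : ∀ i, 0 ≤ C i := fun i => by
    simpa using (norm_nonneg _).trans (hC i 0)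
  have hleibniz := norm_iteratedFDeriv_smul_le (𝕜 := ℝ) (N := ∞) (n := n) hg (ψ.smooth ⊤) x
    (by exact_mod_cast le_top)
  refine (mul_le_mul_of_nonneg_left hleibniz (by positivity)).trans ?_
  rw [Finset.mul_sum]
  refine Finset.sum_le_sum fun i _ => ?_
  have := hC_nonneg i
  calc ‖x‖ ^ k * (n.choose i * ‖iteratedFDeriv ℝ i g x‖ * ‖iteratedFDeriv ℝ (n - i) ψ x‖)
      ≤ ‖x‖ ^ k * (n.choose i * (C i * (1 + ‖x‖)) * ‖iteratedFDeriv ℝ (n - i) ψ x‖) := by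
        gcongr
        exact hC i x
    _ = n.choose i * C i * (‖x‖ ^ k * ‖iteratedFDeriv ℝ (n - i) ψ x‖ +
        ‖x‖ ^ (k + 1) * ‖iteratedFDeriv ℝ (n - i) ψ x‖) := by ring
    _ ≤ _ := by
        gcongr
        · exact le_seminorm ℝ k (n - i) ψ x
        · exact le_seminorm ℝ (k + 1) (n - i) ψ x

variable [InnerProductSpace ℝ E] [FiniteDimensional ℝ E]

lemma exists_norm_iteratedFDeriv_bump_smul_sub_one_le (χ : ContDiffBump (0 : E)) (i : ℕ) :
    ∃ C : ℝ, ∀ ε : ℝ, 0 < ε → ε ≤ 1 → ∀ x : E,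
      ‖iteratedFDeriv ℝ i (fun y => χ (ε • y) - 1) x‖ ≤ ε * C * (1 + ‖x‖) := by
  let χs : 𝓢(E, ℝ) := χ.hasCompactSupport.toSchwartzMap χ.contDiff
  rcases Nat.eq_zero_or_pos i with rfl | hi
  · refine ⟨SchwartzMap.seminorm ℝ 0 1 χs, fun ε hε _ x => ?_⟩
    have hlip : ‖χs (ε • x) - χs 0‖ ≤ SchwartzMap.seminorm ℝ 0 1 χs * ‖ε • x - 0‖ := by
      refine convex_univ.norm_image_sub_le_of_norm_fderiv_le (𝕜 := ℝ)
        (fun y _ => χs.differentiableAt) (fun y _ => ?_) trivial trivial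
      rw [← norm_iteratedFDeriv_one]
      exact norm_iteratedFDeriv_le_seminorm ℝ χs 1 y
    rw [sub_zero, norm_smul, Real.norm_of_nonneg hε.le] at hlip
    have hzero : χs 0 = 1 := χ.one_of_mem_closedBall (Metric.mem_closedBall_self χ.rIn_pos.le)
    rw [norm_iteratedFDeriv_zero, ← hzero]
    refine hlip.trans ?_
    have : 0 ≤ SchwartzMap.seminorm ℝ 0 1 χs := apply_nonneg _ _
    nlinarith [mul_nonneg hε.le this]
  · refine ⟨SchwartzMap.seminorm ℝ 0 i χs, fun ε hε hε1 x => ?_⟩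
    have hscale : iteratedFDeriv ℝ i (fun y => χ (ε • y) - 1) x =
        ε ^ i • iteratedFDeriv ℝ i χs (ε • x) := by
      have hχ : ContDiff ℝ i fun y => χ (ε • y) := χ.contDiff.comp (contDiff_const_smul ε)
      have hsub : (fun y => χ (ε • y) - 1) = (fun y => χ (ε • y)) - fun _ => (1 : ℝ) := rfl
      rw [hsub, iteratedFDeriv_sub_apply hχ.contDiffAt contDiff_const.contDiffAt,
        iteratedFDeriv_const_of_ne hi.ne', Pi.zero_apply, sub_zero,
        iteratedFDeriv_comp_const_smul ε χ.contDiff]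
      rfl
    rw [hscale, norm_smul, norm_pow, Real.norm_of_nonneg hε.le]
    calc ε ^ i * ‖iteratedFDeriv ℝ i χs (ε • x)‖ ≤ ε * SchwartzMap.seminorm ℝ 0 i χs := by
          gcongr
          · exact pow_le_of_le_one hε.le hε1 hi.ne'
          · exact norm_iteratedFDeriv_le_seminorm ℝ χs i (ε • x)
      _ ≤ _ := le_mul_of_one_le_right (mul_nonneg hε.le (apply_nonneg _ _))
          (by linarith [norm_nonneg x])

lemma dense_setOf_hasCompactSupport : Dense {φ : 𝓢(E, F) | HasCompactSupport φ} := by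
  intro ψ
  let χ : ContDiffBump (0 : E) := ⟨1, 2, one_pos, one_lt_two⟩
  choose C hC using exists_norm_iteratedFDeriv_bump_smul_sub_one_le χ
  let ε : ℕ → ℝ := fun m => 1 / (m + 1)
  have hε : ∀ m, 0 < ε m := fun m => Nat.one_div_pos_of_nat
  have hε1 : ∀ m, ε m ≤ 1 := fun m => by
    simpa [ε] using Nat.one_div_le_one_div (α := ℝ) (Nat.zero_le m)
  have hχε : ∀ m, ContDiff ℝ ∞ fun x => χ (ε m • x) := fun m =>
    χ.contDiff.comp (contDiff_const_smul _)
  have hsupp : ∀ m, HasCompactSupport fun x => χ (ε m • x) • ψ x := fun m =>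
    HasCompactSupport.smul_right (χ.hasCompactSupport.comp_smul (hε m).ne')
  let φ : ℕ → 𝓢(E, F) := fun m => (hsupp m).toSchwartzMap ((hχε m).smul (ψ.smooth ⊤))
  refine mem_closure_of_tendsto (f := φ) (b := atTop) ?_ (.of_forall hsupp)
  rw [(schwartz_withSeminorms ℝ E F).tendsto_nhds]
  rintro ⟨k, n⟩ δ hδ
  let K : ℝ := ∑ i ∈ Finset.range (n + 1), n.choose i * |C i| *
    (SchwartzMap.seminorm ℝ k (n - i) ψ + SchwartzMap.seminorm ℝ (k + 1) (n - i) ψ)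
  have hle : ∀ m, SchwartzMap.seminorm ℝ k n (φ m - ψ) ≤ ε m * K := by
    intro m
    refine seminorm_le_bound ℝ k n _ (by have := hε m; positivity) fun x => ?_
    have hdiff : ⇑(φ m - ψ) = fun y => (χ (ε m • y) - 1) • ψ y := by
      ext y
      change χ (ε m • y) • ψ y - ψ y = _
      rw [sub_smul, one_smul]
    rw [hdiff]
    refine (norm_pow_mul_norm_iteratedFDeriv_smul_le (C := fun i => ε m * |C i|)
      ((hχε m).sub contDiff_const) (fun i x => (hC i _ (hε m) (hε1 m) x).trans ?_)
      ψ k n x).trans_eq ?_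
    · have := hε m
      gcongr
      exact le_abs_self _
    · rw [Finset.mul_sum]
      exact Finset.sum_congr rfl fun i _ => by ring
  have hlim : Tendsto (fun m => ε m * K) atTop (𝓝 0) := by
    simpa [ε] using tendsto_one_div_add_atTop_nhds_zero_nat.mul_const K
  filter_upwards [hlim.eventually (gt_mem_nhds hδ)] with m hm
  exact (hle m).trans_lt hm

end Density

end Schwartz

section SobolevEmbedding

open SchwartzMap LineDeriv FourierTransform Laplacian
open scoped ENNReal

variable {E F G 𝕜 : Type*} [NormedAddCommGroup E] [NormedAddCommGroup F] [NormedAddCommGroup G]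
  [RCLike 𝕜]

lemma norm_map_rclike (z : 𝕜) : ‖RCLike.map 𝕜 ℂ z‖ = ‖z‖ := by
  rw [← sq_eq_sq₀ (norm_nonneg _) (norm_nonneg _), RCLike.norm_sq_eq_def, RCLike.norm_sq_eq_def]
  simp [RCLike.map_apply]

variable [InnerProductSpace ℝ E] [NormedSpace ℝ F] [NormedSpace ℝ G]

lemma hasTemperateGrowth_one_add_norm_sq_pow (k : ℕ) :
    (fun x : E => (1 + ‖x‖ ^ 2) ^ k).HasTemperateGrowth :=
  ((Function.HasTemperateGrowth.const (1 : ℝ)).add (Function.hasTemperateGrowth_norm_sq E)).pow k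

lemma lineDerivOp_postcompCLM (L : F →L[ℝ] G) (m : E) (ψ : 𝓢(E, F)) :
    ∂_{m} (postcompCLM L ψ) = postcompCLM L (∂_{m} ψ) := by
  ext x
  rw [postcompCLM_apply, lineDerivOp_apply_eq_fderiv, lineDerivOp_apply_eq_fderiv]
  have hcomp : ⇑(postcompCLM L ψ) = L ∘ ψ := rfl
  rw [hcomp, (L.hasFDerivAt.comp x (ψ.hasFDerivAt x)).fderiv]
  rfl

variable [FiniteDimensional ℝ E]

/-- The Bessel operator `1 - (2π)⁻² Δ`, the Fourier multiplier with symbol `1 + |ξ|²`. -/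
def bessel (ψ : 𝓢(E, F)) : 𝓢(E, F) := ψ - ((2 * Real.pi) ^ 2)⁻¹ • Δ ψ

lemma bessel_iterate_postcompCLM (L : F →L[ℝ] G) (k : ℕ) (ψ : 𝓢(E, F)) :
    bessel^[k] (postcompCLM L ψ) = postcompCLM L (bessel^[k] ψ) := by
  have hstep : Function.Semiconj (postcompCLM L) (bessel : 𝓢(E, F) → 𝓢(E, F)) bessel := by
    intro φ
    simp only [bessel, laplacian_eq_sum (stdOrthonormalBasis ℝ E), lineDerivOp_postcompCLM,
      map_sub, map_smul, map_sum]
  exact (hstep.iterate_right k ψ).symm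

variable [MeasurableSpace E] [BorelSpace E]

section Complex

variable {H : Type*} [NormedAddCommGroup H] [InnerProductSpace ℂ H] [CompleteSpace H]

lemma bessel_eq_fourierMultiplierCLM (ψ : 𝓢(E, H)) :
    bessel ψ = fourierMultiplierCLM H (fun x : E => 1 + ‖x‖ ^ 2) ψ := by
  have hconst : ((2 * Real.pi) ^ 2)⁻¹ * -(2 * Real.pi) ^ 2 = -1 := by
    have := Real.pi_pos
    field_simp
  have hsplit : (fun x : E => 1 + ‖x‖ ^ 2) = (fun _ => (1 : ℝ)) + fun x => ‖x‖ ^ 2 := rfl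
  rw [bessel, laplacian_eq_fourierMultiplierCLM, smul_smul, hconst, neg_one_smul, sub_neg_eq_add,
    fourierMultiplierCLM_apply, fourierMultiplierCLM_apply, hsplit,
    smulLeftCLM_add (F := H) (.const (1 : ℝ)) (Function.hasTemperateGrowth_norm_sq E),
    add_apply, fourierInv_add]
  simp

lemma bessel_iterate_eq_fourierMultiplierCLM (k : ℕ) (ψ : 𝓢(E, H)) :
    bessel^[k] ψ = fourierMultiplierCLM H (fun x : E => (1 + ‖x‖ ^ 2) ^ k) ψ := by
  induction k with
  | zero => simp
  | succ k ih =>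
    rw [Function.iterate_succ_apply', ih, bessel_eq_fourierMultiplierCLM,
      fourierMultiplierCLM_fourierMultiplierCLM_apply
        (by simpa using hasTemperateGrowth_one_add_norm_sq_pow 1)
        (hasTemperateGrowth_one_add_norm_sq_pow k)]
    congr 2
    ext x
    simp only [Pi.mul_apply]
    ring

lemma norm_le_norm_toLp_fourier (ψ : 𝓢(E, H)) (x : E) : ‖ψ x‖ ≤ ‖(𝓕 ψ).toLp 1 volume‖ := by
  have hinv : ψ x = 𝓕 (𝓕 ψ) (-x) := by
    conv_lhs => rw [← FourierTransform.fourierInv_fourier_eq (F := 𝓢(E, H)) ψ]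
    rw [fourierInv_apply_eq]
    simp
  rw [hinv]
  exact norm_fourier_apply_le_toLp_one (𝓕 ψ) (-x)

variable (E) in
lemma exists_eLpNorm_inv_one_add_norm_sq_pow_lt_top : ∃ k : ℕ,
    eLpNorm (fun x : E => ((1 + ‖x‖ ^ 2) ^ k)⁻¹) 2 volume < ⊤ := by
  obtain ⟨k, hk⟩ := Measure.HasTemperateGrowth.exists_eLpNorm_lt_top 2
    (inferInstance : (volume : Measure E).HasTemperateGrowth)
  refine ⟨k, lt_of_le_of_lt (eLpNorm_mono (g := (2 : ℝ) ^ k • fun x : E =>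
    (1 + ‖x‖) ^ (-k : ℝ)) fun x => ?_) ?_⟩
  · rw [Pi.smul_apply, smul_eq_mul, Real.norm_of_nonneg (by positivity),
      Real.norm_of_nonneg (by positivity), Real.rpow_neg (by positivity), Real.rpow_natCast,
      ← div_eq_mul_inv, ← inv_div, ← div_pow]
    gcongr
    rw [div_le_iff₀ two_pos]
    nlinarith [sq_nonneg (‖x‖ - 1), norm_nonneg x]
  · exact eLpNorm_const_smul_le.trans_lt (ENNReal.mul_lt_top (by simp) hk)

variable (E H) in
lemma exists_norm_le_bessel_of_complex : ∃ (k : ℕ) (C : ℝ), 0 ≤ C ∧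
    ∀ (ψ : 𝓢(E, H)) (x : E), ‖ψ x‖ ≤ C * ‖(bessel^[k] ψ).toLp 2 volume‖ := by
  obtain ⟨k, hk⟩ := exists_eLpNorm_inv_one_add_norm_sq_pow_lt_top E
  let a : E → ℝ := fun x => ((1 + ‖x‖ ^ 2) ^ k)⁻¹
  refine ⟨k, (eLpNorm a 2 volume).toReal, ENNReal.toReal_nonneg, fun ψ x => ?_⟩
  let φ : 𝓢(E, H) := smulLeftCLM H (fun x : E => (1 + ‖x‖ ^ 2) ^ k) (𝓕 ψ)
  have hfactor : ⇑(𝓕 ψ : 𝓢(E, H)) = a • ⇑φ := by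
    ext y
    rw [Pi.smul_apply', smulLeftCLM_apply_apply (hasTemperateGrowth_one_add_norm_sq_pow k),
      smul_smul, inv_mul_cancel₀ (by positivity), one_smul]
  have ha : Continuous a := Continuous.inv₀ (by fun_prop) fun y => by positivity
  have hholder : eLpNorm (𝓕 ψ : 𝓢(E, H)) 1 volume ≤ eLpNorm a 2 volume * eLpNorm φ 2 volume := by
    rw [hfactor]
    exact eLpNorm_smul_le_mul_eLpNorm φ.continuous.aestronglyMeasurable ha.aestronglyMeasurable
  calc ‖ψ x‖ ≤ ‖(𝓕 ψ).toLp 1 volume‖ := norm_le_norm_toLp_fourier ψ x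
    _ ≤ (eLpNorm a 2 volume).toReal * ‖φ.toLp 2 volume‖ := by
        rw [norm_toLp, norm_toLp, ← ENNReal.toReal_mul]
        exact ENNReal.toReal_mono (ENNReal.mul_ne_top hk.ne (eLpNorm_lt_top _ _ _).ne) hholder
    _ = _ := by
        rw [← norm_fourier_toL2_eq (bessel^[k] ψ), bessel_iterate_eq_fourierMultiplierCLM,
          fourierMultiplierCLM_apply, FourierTransform.fourier_fourierInv_eq]

end Complex

variable (E 𝕜) in
lemma exists_seminorm_le_bessel : ∃ (k : ℕ) (C : ℝ), 0 ≤ C ∧ ∀ ψ : 𝓢(E, 𝕜),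
    SchwartzMap.seminorm 𝕜 0 0 ψ ≤ C * ‖(bessel^[k] ψ).toLp 2 volume‖ := by
  obtain ⟨k, C, hC, h⟩ := exists_norm_le_bessel_of_complex E ℂ
  refine ⟨k, C, hC, fun ψ => seminorm_le_bound 𝕜 0 0 ψ (by positivity) fun x => ?_⟩
  have hnorm : ∀ (φ : 𝓢(E, 𝕜)) (y : E), ‖postcompCLM (RCLike.map 𝕜 ℂ) φ y‖ = ‖φ y‖ :=
    fun φ y => by rw [postcompCLM_apply, norm_map_rclike]
  rw [pow_zero, one_mul, norm_iteratedFDeriv_zero, ← hnorm]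
  refine (h _ x).trans_eq ?_
  rw [bessel_iterate_postcompCLM, norm_toLp, norm_toLp]
  congr 2
  exact eLpNorm_congr_norm_ae (.of_forall (hnorm _))

end SobolevEmbedding

section Gaussian

variable {E : Type*} [NormedAddCommGroup E]

lemma exists_norm_iteratedFDeriv_exp_comp_le [NormedSpace ℝ E] {f : E → ℝ}
    (hf : f.HasTemperateGrowth) (n : ℕ) : ∃ (k : ℕ) (C : ℝ), 0 ≤ C ∧
      ∀ x, ‖iteratedFDeriv ℝ n (Real.exp ∘ f) x‖ ≤ C * (1 + ‖x‖) ^ k * Real.exp (f x) := by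
  obtain ⟨k, C, hC, hb⟩ := hf.norm_iteratedFDeriv_le_uniform n
  refine ⟨k * n, n.factorial * (1 + C) ^ n, by positivity, fun x => ?_⟩
  have hexp : ∀ i ≤ n, ‖iteratedFDeriv ℝ i Real.exp (f x)‖ ≤ Real.exp (f x) := fun i _ => by
    rw [norm_iteratedFDeriv_eq_norm_iteratedDeriv, iteratedDeriv_eq_iterate,
      Real.iter_deriv_exp, Real.norm_of_nonneg (Real.exp_pos _).le]
  have hf_le : ∀ i, 1 ≤ i → i ≤ n →
      ‖iteratedFDeriv ℝ i f x‖ ≤ ((1 + C) * (1 + ‖x‖) ^ k) ^ i := fun i hi hin => by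
    have hone : 1 ≤ (1 + C) * (1 + ‖x‖) ^ k :=
      one_le_mul_of_one_le_of_one_le (by linarith) (one_le_pow₀ (by linarith [norm_nonneg x]))
    calc ‖iteratedFDeriv ℝ i f x‖ ≤ C * (1 + ‖x‖) ^ k := hb i hin x
      _ ≤ (1 + C) * (1 + ‖x‖) ^ k := by gcongr; linarith
      _ ≤ _ := le_self_pow₀ hone (by omega)
  refine (norm_iteratedFDeriv_comp_le (N := ∞) Real.contDiff_exp hf.1
    (by exact_mod_cast le_top) x hexp hf_le).trans_eq ?_
  rw [mul_pow, ← pow_mul]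
  ring

/-- The function `exp ∘ f` as a Schwartz function, where `f` is of temperate growth and tends to
`-∞` at least linearly. -/
def schwartzExp [NormedSpace ℝ E] {f : E → ℝ} (hf : f.HasTemperateGrowth) {a : ℝ}
    (ha : ∀ x, f x ≤ a - ‖x‖) : 𝓢(E, ℝ) where
  toFun := Real.exp ∘ f
  smooth' := Real.contDiff_exp.comp hf.1
  decay' m n := by
    obtain ⟨k, C, hC, hb⟩ := exists_norm_iteratedFDeriv_exp_comp_le hf n
    refine ⟨C * ((m + k).factorial * Real.exp (a + 1)), fun x => ?_⟩
    have hpow := Real.pow_div_factorial_le_exp (1 + ‖x‖) (by positivity) (m + k)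
    rw [div_le_iff₀ (by positivity)] at hpow
    calc ‖x‖ ^ m * ‖iteratedFDeriv ℝ n (Real.exp ∘ f) x‖
        ≤ (1 + ‖x‖) ^ m * (C * (1 + ‖x‖) ^ k * Real.exp (a - ‖x‖)) := by
          gcongr
          · linarith
          · exact (hb x).trans (by gcongr; exact ha x)
      _ = C * ((1 + ‖x‖) ^ (m + k) * Real.exp (a - ‖x‖)) := by ring
      _ ≤ C * (Real.exp (1 + ‖x‖) * (m + k).factorial * Real.exp (a - ‖x‖)) := by gcongr
      _ = C * ((m + k).factorial * Real.exp (1 + ‖x‖ + (a - ‖x‖))) := by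
          rw [Real.exp_add (1 + ‖x‖)]; ring
      _ = _ := by congr 3; ring

/-- The Gaussian `x ↦ exp (a - b |x|²)` as a Schwartz function. -/
def schwartzGaussian [InnerProductSpace ℝ E] (a : ℝ) {b : ℝ} (hb : 0 < b) : 𝓢(E, ℝ) :=
  schwartzExp (f := fun x => a - b * ‖x‖ ^ 2) (a := a + (4 * b)⁻¹)
    ((Function.HasTemperateGrowth.const a).sub
      ((Function.HasTemperateGrowth.const b).mul (Function.hasTemperateGrowth_norm_sq E)))
    fun x => by
      have hsq : b * ‖x‖ ^ 2 - ‖x‖ + (4 * b)⁻¹ = b * (‖x‖ - (2 * b)⁻¹) ^ 2 := by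
        field_simp
        ring
      nlinarith [mul_nonneg hb.le (sq_nonneg (‖x‖ - (2 * b)⁻¹))]

lemma schwartzGaussian_apply [InnerProductSpace ℝ E] (a : ℝ) {b : ℝ} (hb : 0 < b) (x : E) :
    schwartzGaussian a hb x = Real.exp (a - b * ‖x‖ ^ 2) := rfl

variable {N : ℕ}

lemma sqrt_density_eq_exp (x : Space N) :
    √(density N x) = Real.exp (Real.log (density N 0) / 2 - 1 / 4 * ‖x‖ ^ 2) := by
  have hsplit : density N x = density N 0 * Real.exp (-‖x‖ ^ 2 / 2) := by simp [density]
  rw [hsplit, ← Real.exp_log (density_pos N 0), ← Real.exp_add, ← Real.exp_half, Real.log_exp]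
  congr 1
  ring

lemma hasFDerivAt_sqrt_density (x : Space N) :
    HasFDerivAt (fun y => √(density N y)) (-(√(density N x) / 2) • innerSL ℝ x) x := by
  have hexponent := ((hasStrictFDerivAt_norm_sq x).hasFDerivAt.const_mul (1 / 4 : ℝ)).const_sub
    (Real.log (density N 0) / 2)
  simp only [sqrt_density_eq_exp]
  refine hexponent.exp.congr_fderiv ?_
  ext y
  simp
  ring

lemma memLp_exp_mul_sqrt_density (c : ℝ) :
    MemLp (fun x : Space N => Real.exp (c * ‖x‖) * √(density N x)) 2 volume := by
  let g : 𝓢(Space N, ℝ) := schwartzGaussian (2 * c ^ 2 + Real.log (density N 0) / 2)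
    (by norm_num : (0 : ℝ) < 1 / 8)
  refine (g.memLp 2 volume).mono (Continuous.aestronglyMeasurable
    ((by fun_prop : Continuous fun x : Space N => Real.exp (c * ‖x‖)).mul
      (contDiff_sqrt_density N).continuous)) (.of_forall fun x => ?_)
  rw [sqrt_density_eq_exp, ← Real.exp_add, schwartzGaussian_apply,
    Real.norm_of_nonneg (Real.exp_pos _).le, Real.norm_of_nonneg (Real.exp_pos _).le]
  gcongr
  nlinarith [sq_nonneg (‖x‖ - 4 * c)]

end Gaussian

section LadderOperators

open SchwartzMap LineDeriv

lemma lineDerivOp_comm {E F : Type*} [NormedAddCommGroup E] [NormedSpace ℝ E]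
    [NormedAddCommGroup F] [NormedSpace ℝ F] (v w : E) (ψ : 𝓢(E, F)) :
    ∂_{v} (∂_{w} ψ) = ∂_{w} (∂_{v} ψ) := by
  have hsnd : ∀ (v w : E) x, (∂_{v} (∂_{w} ψ) : 𝓢(E, F)) x =
      fderiv ℝ (fderiv ℝ ψ) x v w := fun v w x => by
    have hderiv : HasFDerivAt (fderiv ℝ ψ) (fderiv ℝ (fderiv ℝ ψ) x) x :=
      (fderivCLM ℝ E F ψ).hasFDerivAt x
    have hw : ⇑(∂_{w} ψ : 𝓢(E, F)) = fun y => fderiv ℝ ψ y w :=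
      funext (lineDerivOp_apply_eq_fderiv w ψ)
    rw [lineDerivOp_apply_eq_fderiv, hw, (hderiv.clm_apply (hasFDerivAt_const w x)).fderiv]
    simp
  ext x
  rw [hsnd, hsnd]
  exact second_derivative_symmetric (𝕜 := ℝ) (fun y => ψ.hasFDerivAt y)
    ((fderivCLM ℝ E F ψ).hasFDerivAt x) v w

variable {N : ℕ} {𝕜 : Type*} [RCLike 𝕜]

variable (N 𝕜) in
/-- The ground state `(p^N)^{1/2}` of the number operator. -/
def ground : 𝓢(Space N, 𝕜) :=
  postcompCLM (RCLike.ofRealCLM (K := 𝕜))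
    (schwartzGaussian (Real.log (density N 0) / 2) (by norm_num : (0 : ℝ) < 1 / 4))

lemma ground_apply (x : Space N) : ground N 𝕜 x = ((√(density N x) : ℝ) : 𝕜) := by
  rw [ground, postcompCLM_apply, schwartzGaussian_apply, ← sqrt_density_eq_exp]
  rfl

lemma hasTemperateGrowth_coord (i : Fin N) :
    (fun x : Space N => ((x i : ℝ) : 𝕜)).HasTemperateGrowth :=
  ((RCLike.ofRealCLM (K := 𝕜)).comp
    (EuclideanSpace.proj i : Space N →L[ℝ] ℝ)).hasTemperateGrowth

/-- Multiplication by `x_i`. -/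
def mulCoord (i : Fin N) : 𝓢(Space N, 𝕜) →L[𝕜] 𝓢(Space N, 𝕜) :=
  smulLeftCLM 𝕜 fun x : Space N => ((x i : ℝ) : 𝕜)

/-- The derivative `∂/∂x_i`. -/
def derivCoord (i : Fin N) : 𝓢(Space N, 𝕜) →L[𝕜] 𝓢(Space N, 𝕜) :=
  lineDerivOpCLM 𝕜 𝓢(Space N, 𝕜) (EuclideanSpace.single i (1 : ℝ) : Space N)

lemma mulCoord_apply (i : Fin N) (ψ : 𝓢(Space N, 𝕜)) (x : Space N) :
    mulCoord i ψ x = (x i : 𝕜) * ψ x :=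
  smulLeftCLM_apply_apply (hasTemperateGrowth_coord i) ψ x

lemma derivCoord_apply (i : Fin N) (ψ : 𝓢(Space N, 𝕜)) (x : Space N) :
    derivCoord i ψ x = fderiv ℝ ψ x (EuclideanSpace.single i 1) := rfl

lemma derivCoord_eq (i : Fin N) (ψ : 𝓢(Space N, 𝕜)) :
    derivCoord i ψ = ∂_{(EuclideanSpace.single i (1 : ℝ) : Space N)} ψ := rfl

lemma mulCoord_comm (i j : Fin N) (ψ : 𝓢(Space N, 𝕜)) :
    mulCoord i (mulCoord j ψ) = mulCoord j (mulCoord i ψ) := by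
  ext x
  simp only [mulCoord_apply]
  ring

lemma derivCoord_comm (i j : Fin N) (ψ : 𝓢(Space N, 𝕜)) :
    derivCoord i (derivCoord j ψ) = derivCoord j (derivCoord i ψ) :=
  lineDerivOp_comm _ _ ψ

lemma derivCoord_mulCoord (i j : Fin N) (ψ : 𝓢(Space N, 𝕜)) :
    derivCoord i (mulCoord j ψ) = mulCoord j (derivCoord i ψ) + if i = j then ψ else 0 := by
  ext x
  let p : Space N →L[ℝ] 𝕜 := (RCLike.ofRealCLM (K := 𝕜)).comp
    (EuclideanSpace.proj j : Space N →L[ℝ] ℝ)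
  have hmul : ⇑(mulCoord j ψ) = ⇑p * ⇑ψ := funext (mulCoord_apply j ψ)
  have hp : p (EuclideanSpace.single i 1) = if i = j then 1 else 0 := by
    simp [p, eq_comm]
  rw [derivCoord_apply, hmul, (p.hasFDerivAt.mul (ψ.hasFDerivAt x)).fderiv]
  simp only [add_apply, mulCoord_apply, derivCoord_apply, smul_apply, smul_eq_mul, hp]
  split_ifs <;> simp [p]

/-- The annihilation operator `∂/∂x_i + x_i/2`. -/
def annih (i : Fin N) : 𝓢(Space N, 𝕜) →L[𝕜] 𝓢(Space N, 𝕜) :=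
  derivCoord i + (2⁻¹ : 𝕜) • mulCoord i

/-- The creation operator `-∂/∂x_i + x_i/2`. -/
def creat (i : Fin N) : 𝓢(Space N, 𝕜) →L[𝕜] 𝓢(Space N, 𝕜) :=
  -derivCoord i + (2⁻¹ : 𝕜) • mulCoord i

lemma annih_apply (i : Fin N) (ψ : 𝓢(Space N, 𝕜)) :
    annih i ψ = derivCoord i ψ + (2⁻¹ : 𝕜) • mulCoord i ψ := rfl

lemma creat_apply (i : Fin N) (ψ : 𝓢(Space N, 𝕜)) :
    creat i ψ = -derivCoord i ψ + (2⁻¹ : 𝕜) • mulCoord i ψ := rfl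

lemma mulCoord_eq_ladder (i : Fin N) (ψ : 𝓢(Space N, 𝕜)) :
    mulCoord i ψ = annih i ψ + creat i ψ := by
  rw [annih_apply, creat_apply, add_add_add_comm, add_neg_cancel, zero_add, ← add_smul,
    ← two_mul, mul_inv_cancel₀ two_ne_zero, one_smul]

lemma derivCoord_eq_ladder (i : Fin N) (ψ : 𝓢(Space N, 𝕜)) :
    derivCoord i ψ = (2⁻¹ : 𝕜) • annih i ψ - (2⁻¹ : 𝕜) • creat i ψ := by
  rw [← smul_sub, annih_apply, creat_apply, add_sub_add_right_eq_sub, sub_neg_eq_add,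
    ← two_smul 𝕜, smul_smul, inv_mul_cancel₀ two_ne_zero, one_smul]

lemma creat_comm (i j : Fin N) (ψ : 𝓢(Space N, 𝕜)) :
    creat i (creat j ψ) = creat j (creat i ψ) := by
  simp only [creat_apply, map_add, map_neg, map_smul, derivCoord_mulCoord, derivCoord_comm i j,
    mulCoord_comm i j, eq_comm (a := i)]
  module

lemma annih_creat (i j : Fin N) (ψ : 𝓢(Space N, 𝕜)) :
    annih i (creat j ψ) = creat j (annih i ψ) + if i = j then ψ else 0 := by
  simp only [creat_apply, annih_apply, map_add, map_neg, map_smul, derivCoord_mulCoord,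
    derivCoord_comm i j, mulCoord_comm i j, eq_comm (a := i)]
  module

lemma annih_sqrt_density_mul (i : Fin N) (ψ : 𝓢(Space N, 𝕜)) (φ : Space N → 𝕜) (x : Space N)
    (hφ : DifferentiableAt ℝ φ x) (h : ∀ y, ψ y = (√(density N y) : 𝕜) * φ y) :
    annih i ψ x = (√(density N x) : 𝕜) * fderiv ℝ φ x (EuclideanSpace.single i 1) := by
  have hsqrt : HasFDerivAt (fun y => (√(density N y) : 𝕜))
      ((RCLike.ofRealCLM (K := 𝕜)).comp (-(√(density N x) / 2) • innerSL ℝ x)) x :=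
    (RCLike.ofRealCLM (K := 𝕜)).hasFDerivAt.comp x (hasFDerivAt_sqrt_density x)
  have hψ : ⇑ψ = (fun y => (√(density N y) : 𝕜)) * φ := funext h
  have hcoord : inner ℝ x (EuclideanSpace.single i (1 : ℝ)) = x i := by
    rw [EuclideanSpace.inner_single_right]; simp
  rw [annih_apply, add_apply, smul_apply, derivCoord_apply, mulCoord_apply, hψ,
    (hsqrt.mul hφ.hasFDerivAt).fderiv]
  simp only [add_apply, smul_apply, Pi.mul_apply, ContinuousLinearMap.comp_apply,
    innerSL_apply_apply, smul_eq_mul, RCLike.ofRealCLM_apply, hcoord]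
  push_cast
  ring

lemma annih_ground (i : Fin N) : annih i (ground N 𝕜) = 0 := by
  ext x
  rw [annih_sqrt_density_mul i (ground N 𝕜) (fun _ => 1) x (differentiableAt_const _)
    fun y => by rw [ground_apply, mul_one]]
  simp

/-- The `n`-particle space, spanned by the Hermite functions of degree `n`. -/
def hermiteSpace (N : ℕ) (𝕜 : Type*) [RCLike 𝕜] : ℕ → Submodule 𝕜 𝓢(Space N, 𝕜)
  | 0 => Submodule.span 𝕜 {ground N 𝕜}
  | n + 1 => ⨆ i : Fin N, (hermiteSpace N 𝕜 n).map (creat i).toLinearMap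

instance finiteDimensional_hermiteSpace (n : ℕ) :
    FiniteDimensional 𝕜 (hermiteSpace N 𝕜 n) := by
  induction n with
  | zero => exact inferInstanceAs (FiniteDimensional 𝕜 (Submodule.span 𝕜 {ground N 𝕜}))
  | succ n ih =>
    exact inferInstanceAs (FiniteDimensional 𝕜
      ↥(⨆ i : Fin N, (hermiteSpace N 𝕜 n).map (creat i).toLinearMap))

lemma ground_mem_hermiteSpace : ground N 𝕜 ∈ hermiteSpace N 𝕜 0 :=
  Submodule.mem_span_singleton_self _

lemma creat_mem_hermiteSpace (i : Fin N) {n : ℕ} {w : 𝓢(Space N, 𝕜)} (hw : w ∈ hermiteSpace N 𝕜 n) :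
    creat i w ∈ hermiteSpace N 𝕜 (n + 1) :=
  Submodule.mem_iSup_of_mem (p := fun i : Fin N =>
    (hermiteSpace N 𝕜 n).map (creat i).toLinearMap) i (Submodule.mem_map_of_mem hw)

lemma hermiteSpace_succ_induction {n : ℕ} {p : 𝓢(Space N, 𝕜) → Prop}
    (hcreat : ∀ i, ∀ w ∈ hermiteSpace N 𝕜 n, p (creat i w)) (hzero : p 0)
    (hadd : ∀ v w, p v → p w → p (v + w)) {w : 𝓢(Space N, 𝕜)}
    (hw : w ∈ hermiteSpace N 𝕜 (n + 1)) : p w := by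
  refine Submodule.iSup_induction (fun i : Fin N =>
    (hermiteSpace N 𝕜 n).map (creat i).toLinearMap) (motive := p) hw ?_ hzero hadd
  rintro i _ ⟨v, hv, rfl⟩
  exact hcreat i v hv

lemma annih_of_mem_hermiteSpace_zero (i : Fin N) {w : 𝓢(Space N, 𝕜)} (hw : w ∈ hermiteSpace N 𝕜 0) :
    annih i w = 0 := by
  obtain ⟨c, rfl⟩ := Submodule.mem_span_singleton.1 hw
  rw [map_smul, annih_ground, smul_zero]

lemma annih_mem_hermiteSpace (i : Fin N) {n : ℕ} {w : 𝓢(Space N, 𝕜)}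
    (hw : w ∈ hermiteSpace N 𝕜 (n + 1)) :
    annih i w ∈ hermiteSpace N 𝕜 n := by
  induction n generalizing w with
  | zero =>
    refine hermiteSpace_succ_induction (p := fun w => annih i w ∈ hermiteSpace N 𝕜 0)
      (fun j v hv => ?_) (by simp) (fun v w hv hw => by rw [map_add]; exact add_mem hv hw) hw
    rw [annih_creat, annih_of_mem_hermiteSpace_zero i hv, map_zero, zero_add]
    split_ifs
    exacts [hv, zero_mem _]
  | succ n ih =>
    refine hermiteSpace_succ_induction (p := fun w => annih i w ∈ hermiteSpace N 𝕜 (n + 1))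
      (fun j v hv => ?_) (by simp) (fun v w hv hw => by rw [map_add]; exact add_mem hv hw) hw
    rw [annih_creat]
    refine add_mem (creat_mem_hermiteSpace j (ih hv)) ?_
    split_ifs
    exacts [hv, zero_mem _]

/-- The number operator `∑ (-∂/∂x_i + x_i/2)(∂/∂x_i + x_i/2)`, which is `L` conjugated by
`(p^N)^{1/2}`. -/
def number (N : ℕ) (𝕜 : Type*) [RCLike 𝕜] : 𝓢(Space N, 𝕜) →L[𝕜] 𝓢(Space N, 𝕜) :=
  ∑ i, (creat i) ∘L (annih i)

lemma number_apply (ψ : 𝓢(Space N, 𝕜)) : number N 𝕜 ψ = ∑ i, creat i (annih i ψ) := by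
  simp [number]

lemma number_creat (j : Fin N) (ψ : 𝓢(Space N, 𝕜)) :
    number N 𝕜 (creat j ψ) = creat j (number N 𝕜 ψ) + creat j ψ := by
  simp only [number_apply, annih_creat, map_add, Finset.sum_add_distrib, map_sum, creat_comm j]
  congr 1
  rw [Finset.sum_eq_single j] <;> simp +contextual

lemma number_of_mem_hermiteSpace {n : ℕ} {w : 𝓢(Space N, 𝕜)} (hw : w ∈ hermiteSpace N 𝕜 n) :
    number N 𝕜 w = (n : 𝕜) • w := by
  induction n generalizing w with
  | zero => simp [number_apply, annih_of_mem_hermiteSpace_zero _ hw]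
  | succ n ih =>
    refine hermiteSpace_succ_induction (p := fun w => number N 𝕜 w = ((n + 1 : ℕ) : 𝕜) • w)
      (fun j v hv => ?_) (by simp) (fun v w hv hw => by rw [map_add, hv, hw, smul_add]) hw
    rw [number_creat, ih hv, map_smul]
    push_cast
    rw [add_smul, one_smul]

end LadderOperators

section PolynomialBounds

open SchwartzMap LineDeriv
open scoped InnerProductSpace ComplexConjugate

/-- `L²(dx)`. -/
abbrev FlatL2 (N : ℕ) (𝕜 : Type*) [RCLike 𝕜] : Type _ := Lp 𝕜 2 (volume : Measure (Space N))

/-- The embedding of the Schwartz space into `L²(dx)`. -/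
def embL2 (N : ℕ) (𝕜 : Type*) [RCLike 𝕜] : 𝓢(Space N, 𝕜) →L[𝕜] FlatL2 N 𝕜 :=
  toLpCLM 𝕜 𝕜 2 (volume : Measure (Space N))

variable {N : ℕ} {𝕜 : Type*} [RCLike 𝕜]

lemma coeFn_embL2 (ψ : 𝓢(Space N, 𝕜)) : embL2 N 𝕜 ψ =ᵐ[volume] ψ := ψ.coeFn_toLp 2 volume

lemma embL2_injective : Function.Injective (embL2 N 𝕜) := injective_toLp 2 volume

lemma inner_embL2 (ψ : 𝓢(Space N, 𝕜)) (u : FlatL2 N 𝕜) :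
    ⟪embL2 N 𝕜 ψ, u⟫_𝕜 = ∫ x, conj (ψ x) * u x := by
  rw [L2.inner_def]
  refine integral_congr_ae ?_
  filter_upwards [coeFn_embL2 ψ] with x hx
  rw [hx, RCLike.inner_apply, mul_comm]

lemma inner_embL2_embL2 (φ ψ : 𝓢(Space N, 𝕜)) :
    ⟪embL2 N 𝕜 φ, embL2 N 𝕜 ψ⟫_𝕜 = ∫ x, conj (φ x) * ψ x := by
  rw [inner_embL2]
  refine integral_congr_ae ?_
  filter_upwards [coeFn_embL2 ψ] with x hx
  rw [hx]

lemma inner_derivCoord (i : Fin N) (φ ψ : 𝓢(Space N, 𝕜)) :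
    ⟪embL2 N 𝕜 (derivCoord i φ), embL2 N 𝕜 ψ⟫_𝕜 =
      -⟪embL2 N 𝕜 φ, embL2 N 𝕜 (derivCoord i ψ)⟫_𝕜 := by
  rw [inner_embL2_embL2, inner_embL2_embL2]
  have hparts := integral_bilinear_lineDerivOp_right_eq_neg_left
    (μ := (volume : Measure (Space N))) φ ψ
    ((ContinuousLinearMap.mul ℝ 𝕜).comp (RCLike.conjCLE (K := 𝕜)).toContinuousLinearMap)
    (EuclideanSpace.single i (1 : ℝ))
  simp only [ContinuousLinearMap.comp_apply, ContinuousLinearMap.mul_apply',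
    ContinuousLinearEquiv.coe_coe, RCLike.conjCLE_apply] at hparts
  simp only [derivCoord_eq]
  rw [hparts, neg_neg]

lemma inner_mulCoord (i : Fin N) (φ ψ : 𝓢(Space N, 𝕜)) :
    ⟪embL2 N 𝕜 (mulCoord i φ), embL2 N 𝕜 ψ⟫_𝕜 =
      ⟪embL2 N 𝕜 φ, embL2 N 𝕜 (mulCoord i ψ)⟫_𝕜 := by
  rw [inner_embL2_embL2, inner_embL2_embL2]
  congr 1
  ext x
  simp only [mulCoord_apply, map_mul, RCLike.conj_ofReal]
  ring

lemma inner_annih (i : Fin N) (φ ψ : 𝓢(Space N, 𝕜)) :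
    ⟪embL2 N 𝕜 (annih i φ), embL2 N 𝕜 ψ⟫_𝕜 =
      ⟪embL2 N 𝕜 φ, embL2 N 𝕜 (creat i ψ)⟫_𝕜 := by
  simp only [annih_apply, creat_apply, map_add, map_smul, map_neg, inner_add_left, inner_add_right,
    inner_smul_left, inner_smul_right, inner_neg_right, inner_derivCoord, inner_mulCoord, map_inv₀,
    map_ofNat]

lemma inner_creat (i : Fin N) (φ ψ : 𝓢(Space N, 𝕜)) :
    ⟪embL2 N 𝕜 (creat i φ), embL2 N 𝕜 ψ⟫_𝕜 =
      ⟪embL2 N 𝕜 φ, embL2 N 𝕜 (annih i ψ)⟫_𝕜 := by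
  rw [← inner_conj_symm, ← inner_annih, inner_conj_symm]

lemma inner_number (φ ψ : 𝓢(Space N, 𝕜)) :
    ⟪embL2 N 𝕜 (number N 𝕜 φ), embL2 N 𝕜 ψ⟫_𝕜 =
      ⟪embL2 N 𝕜 φ, embL2 N 𝕜 (number N 𝕜 ψ)⟫_𝕜 := by
  simp only [number_apply, map_sum, sum_inner, inner_sum, inner_creat, inner_annih]

lemma sum_norm_annih_sq {n : ℕ} {w : 𝓢(Space N, 𝕜)} (hw : w ∈ hermiteSpace N 𝕜 n) :
    ∑ i, ‖embL2 N 𝕜 (annih i w)‖ ^ 2 = n * ‖embL2 N 𝕜 w‖ ^ 2 := by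
  apply RCLike.ofReal_injective (K := 𝕜)
  push_cast
  simp only [← inner_self_eq_norm_sq_to_K (𝕜 := 𝕜), inner_annih]
  rw [← inner_sum, ← map_sum, ← number_apply, number_of_mem_hermiteSpace hw, map_smul,
    inner_smul_right]

lemma norm_creat_sq (i : Fin N) (w : 𝓢(Space N, 𝕜)) :
    ‖embL2 N 𝕜 (creat i w)‖ ^ 2 = ‖embL2 N 𝕜 (annih i w)‖ ^ 2 + ‖embL2 N 𝕜 w‖ ^ 2 := by
  apply RCLike.ofReal_injective (K := 𝕜)
  push_cast
  simp only [← inner_self_eq_norm_sq_to_K (𝕜 := 𝕜)]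
  rw [inner_creat, annih_creat, if_pos rfl, map_add, inner_add_right, inner_annih]

lemma norm_annih_sq_le (i : Fin N) {n : ℕ} {w : 𝓢(Space N, 𝕜)} (hw : w ∈ hermiteSpace N 𝕜 n) :
    ‖embL2 N 𝕜 (annih i w)‖ ^ 2 ≤ n * ‖embL2 N 𝕜 w‖ ^ 2 := by
  rw [← sum_norm_annih_sq hw]
  exact Finset.single_le_sum (f := fun j => ‖embL2 N 𝕜 (annih j w)‖ ^ 2)
    (fun j _ => by positivity) (Finset.mem_univ i)

lemma norm_creat_le (i : Fin N) {n : ℕ} {w : 𝓢(Space N, 𝕜)} (hw : w ∈ hermiteSpace N 𝕜 n) :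
    ‖embL2 N 𝕜 (creat i w)‖ ≤ √(n + 1) * ‖embL2 N 𝕜 w‖ := by
  refine (pow_le_pow_iff_left₀ (norm_nonneg _) (by positivity) two_ne_zero).1 ?_
  rw [mul_pow, Real.sq_sqrt (by positivity), norm_creat_sq, add_one_mul]
  gcongr
  exact norm_annih_sq_le i hw

lemma norm_annih_le (i : Fin N) {n : ℕ} {w : 𝓢(Space N, 𝕜)} (hw : w ∈ hermiteSpace N 𝕜 n) :
    ‖embL2 N 𝕜 (annih i w)‖ ≤ √n * ‖embL2 N 𝕜 w‖ := by
  refine (pow_le_pow_iff_left₀ (norm_nonneg _) (by positivity) two_ne_zero).1 ?_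
  rw [mul_pow, Real.sq_sqrt (by positivity)]
  exact norm_annih_sq_le i hw

/-- A seminorm on the Schwartz space that grows at most polynomially, relative to the `L²` norm,
on the Hermite spaces. -/
def PolyBounded (q : Seminorm 𝕜 𝓢(Space N, 𝕜)) : Prop :=
  ∃ (C : ℝ) (M : ℕ), 0 ≤ C ∧ ∀ n, ∀ w ∈ hermiteSpace N 𝕜 n,
    q w ≤ C * (1 + n) ^ M * ‖embL2 N 𝕜 w‖

lemma PolyBounded.mono {p q : Seminorm 𝕜 𝓢(Space N, 𝕜)} (hq : PolyBounded q)
    (h : ∀ w, p w ≤ q w) : PolyBounded p := by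
  obtain ⟨C, M, hC, hb⟩ := hq
  exact ⟨C, M, hC, fun n w hw => (h w).trans (hb n w hw)⟩

lemma PolyBounded.add {p q : Seminorm 𝕜 𝓢(Space N, 𝕜)} (hp : PolyBounded p)
    (hq : PolyBounded q) : PolyBounded (p + q) := by
  obtain ⟨C, M, hC, hb⟩ := hp
  obtain ⟨C', M', hC', hb'⟩ := hq
  refine ⟨C + C', M + M', by positivity, fun n w hw => ?_⟩
  have hone : (1 : ℝ) ≤ 1 + n := by simp
  calc p w + q w ≤ C * (1 + n) ^ M * ‖embL2 N 𝕜 w‖ + C' * (1 + n) ^ M' * ‖embL2 N 𝕜 w‖ :=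
        add_le_add (hb n w hw) (hb' n w hw)
    _ ≤ C * (1 + n) ^ (M + M') * ‖embL2 N 𝕜 w‖ + C' * (1 + n) ^ (M + M') * ‖embL2 N 𝕜 w‖ := by
        gcongr <;> first | exact hone | omega
    _ = _ := by ring

lemma PolyBounded.zero : PolyBounded (0 : Seminorm 𝕜 𝓢(Space N, 𝕜)) :=
  ⟨0, 0, le_rfl, fun n w _ => by simp⟩

lemma PolyBounded.sum {ι : Type*} {s : Finset ι} {q : ι → Seminorm 𝕜 𝓢(Space N, 𝕜)}
    (hq : ∀ i ∈ s, PolyBounded (q i)) : PolyBounded (∑ i ∈ s, q i) :=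
  Finset.sum_induction q PolyBounded (fun _ _ => PolyBounded.add) PolyBounded.zero hq

lemma sqrt_natCast_le_one_add (n : ℕ) : √(n : ℝ) ≤ 1 + n :=
  Real.sqrt_le_iff.2 ⟨by positivity, by nlinarith [(Nat.cast_nonneg n : (0 : ℝ) ≤ n)]⟩

lemma PolyBounded.comp_annih {q : Seminorm 𝕜 𝓢(Space N, 𝕜)} (hq : PolyBounded q) (i : Fin N) :
    PolyBounded (q.comp (annih i).toLinearMap) := by
  obtain ⟨C, M, hC, hb⟩ := hq
  refine ⟨C, M + 1, hC, fun n w hw => ?_⟩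
  change q (annih i w) ≤ _
  rcases n with _ | n
  · rw [annih_of_mem_hermiteSpace_zero i hw, map_zero]
    positivity
  · calc q (annih i w) ≤ C * (1 + n) ^ M * ‖embL2 N 𝕜 (annih i w)‖ :=
          hb n _ (annih_mem_hermiteSpace i hw)
      _ ≤ C * (1 + (n + 1 : ℕ)) ^ M * ((1 + (n + 1 : ℕ)) * ‖embL2 N 𝕜 w‖) := by
          gcongr
          · simp
          · exact (norm_annih_le i hw).trans (by gcongr; exact sqrt_natCast_le_one_add _)
      _ = _ := by ring

lemma PolyBounded.comp_creat {q : Seminorm 𝕜 𝓢(Space N, 𝕜)} (hq : PolyBounded q) (i : Fin N) :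
    PolyBounded (q.comp (creat i).toLinearMap) := by
  obtain ⟨C, M, hC, hb⟩ := hq
  refine ⟨C * 2 ^ (M + 1), M + 1, by positivity, fun n w hw => ?_⟩
  have hdouble : (1 + (n + 1 : ℕ) : ℝ) ≤ 2 * (1 + n) := by
    push_cast
    linarith [(Nat.cast_nonneg n : (0 : ℝ) ≤ n)]
  calc q (creat i w) ≤ C * (1 + (n + 1 : ℕ)) ^ M * ‖embL2 N 𝕜 (creat i w)‖ :=
        hb (n + 1) _ (creat_mem_hermiteSpace i hw)
    _ ≤ C * (1 + (n + 1 : ℕ)) ^ M * ((1 + (n + 1 : ℕ)) * ‖embL2 N 𝕜 w‖) := by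
        gcongr
        refine (norm_creat_le i hw).trans ?_
        rw [← Nat.cast_add_one]
        gcongr
        exact sqrt_natCast_le_one_add _
    _ ≤ C * (2 * (1 + n)) ^ M * (2 * (1 + n) * ‖embL2 N 𝕜 w‖) := by gcongr
    _ = _ := by rw [mul_pow]; ring

/-- The operators on the Schwartz space under which polynomial boundedness is stable. -/
def tame (N : ℕ) (𝕜 : Type*) [RCLike 𝕜] : Subalgebra 𝕜 (𝓢(Space N, 𝕜) →L[𝕜] 𝓢(Space N, 𝕜)) where
  carrier := {T | ∀ q, PolyBounded q → PolyBounded (q.comp T.toLinearMap)}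
  mul_mem' {S T} hS hT q hq := (hT _ (hS q hq)).mono fun _ => le_rfl
  add_mem' {S T} hS hT q hq := ((hS q hq).add (hT q hq)).mono fun w => map_add_le_add q _ _
  algebraMap_mem' c q hq := by
    obtain ⟨C, M, hC, hb⟩ := hq
    refine ⟨‖c‖ * C, M, by positivity, fun n w hw => ?_⟩
    have hsmul : (q.comp (algebraMap 𝕜 (𝓢(Space N, 𝕜) →L[𝕜] 𝓢(Space N, 𝕜)) c).toLinearMap) w =
        ‖c‖ * q w := map_smul_eq_mul q c w
    rw [hsmul, mul_assoc, mul_assoc, ← mul_assoc C]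
    exact mul_le_mul_of_nonneg_left (hb n w hw) (norm_nonneg c)

lemma mulCoord_mem_tame (i : Fin N) : mulCoord i ∈ tame N 𝕜 := by
  have hladder : (mulCoord i : 𝓢(Space N, 𝕜) →L[𝕜] 𝓢(Space N, 𝕜)) = annih i + creat i := by
    ext1 ψ; exact mulCoord_eq_ladder i ψ
  rw [hladder]
  exact add_mem (fun q hq => hq.comp_annih i) (fun q hq => hq.comp_creat i)

lemma derivCoord_mem_tame (i : Fin N) : derivCoord i ∈ tame N 𝕜 := by
  have hladder : (derivCoord i : 𝓢(Space N, 𝕜) →L[𝕜] 𝓢(Space N, 𝕜)) =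
      (2⁻¹ : 𝕜) • annih i - (2⁻¹ : 𝕜) • creat i := by
    ext1 ψ; exact derivCoord_eq_ladder i ψ
  rw [hladder]
  exact sub_mem (Subalgebra.smul_mem _ (fun q hq => hq.comp_annih i) _)
    (Subalgebra.smul_mem _ (fun q hq => hq.comp_creat i) _)

lemma exists_tame_iteratedLineDerivOp {n : ℕ} (I : Fin n → Fin N) : ∃ T ∈ tame N 𝕜,
    ∀ ψ : 𝓢(Space N, 𝕜), ∂^{fun j => (EuclideanSpace.single (I j) (1 : ℝ) : Space N)} ψ = T ψ := by
  induction n with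
  | zero => exact ⟨1, one_mem _, fun ψ => by simp⟩
  | succ n ih =>
    obtain ⟨T, hT, h⟩ := ih (Fin.tail I)
    refine ⟨derivCoord (I 0) * T, mul_mem (derivCoord_mem_tame _) hT, fun ψ => ?_⟩
    rw [iteratedLineDerivOp_succ_left]
    exact congrArg _ (h ψ)

lemma exists_tame_norm_sq_pow (k : ℕ) : ∃ T ∈ tame N 𝕜,
    ∀ ψ : 𝓢(Space N, 𝕜), smulLeftCLM 𝕜 (fun x : Space N => (‖x‖ ^ 2) ^ k) ψ = T ψ := by
  refine ⟨(∑ i, mulCoord i * mulCoord i) ^ k, pow_mem (sum_mem fun i _ =>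
    mul_mem (mulCoord_mem_tame i) (mulCoord_mem_tame i)) k, fun ψ => ?_⟩
  have htemperate : ∀ k : ℕ, (fun x : Space N => (‖x‖ ^ 2) ^ k).HasTemperateGrowth := fun k =>
    (Function.hasTemperateGrowth_norm_sq (Space N)).pow k
  ext x
  rw [smulLeftCLM_apply_apply (htemperate k)]
  induction k with
  | zero => simp
  | succ k ih =>
    rw [pow_succ' (‖x‖ ^ 2) k, pow_succ' _ k, mul_smul, ih, mul_apply_eq_comp,
      EuclideanSpace.norm_sq_eq]
    simp [mulCoord_apply, Finset.sum_mul, RCLike.real_smul_eq_coe_mul, ← mul_assoc, ← sq]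

lemma exists_tame_bessel : ∃ T ∈ tame N 𝕜, ∀ ψ : 𝓢(Space N, 𝕜), bessel ψ = T ψ := by
  refine ⟨1 - ((((2 * Real.pi) ^ 2)⁻¹ : ℝ) : 𝕜) • ∑ i, derivCoord i * derivCoord i,
    sub_mem (one_mem _) (Subalgebra.smul_mem _ (sum_mem fun i _ =>
      mul_mem (derivCoord_mem_tame i) (derivCoord_mem_tame i)) _), fun ψ => ?_⟩
  rw [bessel, SchwartzMap.laplacian_eq_sum (EuclideanSpace.basisFun (Fin N) ℝ)]
  ext x
  simp [RCLike.real_smul_eq_coe_mul, derivCoord_eq]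

lemma polyBounded_seminorm_zero :
    PolyBounded (SchwartzMap.seminorm 𝕜 0 0 : Seminorm 𝕜 𝓢(Space N, 𝕜)) := by
  obtain ⟨k, C, hC, hb⟩ := exists_seminorm_le_bessel (Space N) 𝕜
  obtain ⟨T, hT, hbessel⟩ := exists_tame_bessel (N := N) (𝕜 := 𝕜)
  have hnorm : PolyBounded (C.toNNReal •
      (normSeminorm 𝕜 (FlatL2 N 𝕜)).comp (embL2 N 𝕜).toLinearMap) :=
    ⟨C, 0, hC, fun n w _ => by simp [NNReal.smul_def, hC]⟩
  refine (pow_mem hT k _ hnorm).mono fun w => (hb w).trans_eq ?_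
  have hiter : bessel^[k] w = (T ^ k) w := by rw [FunLike.coe_pow_eq_iterate, funext hbessel]
  simp only [Seminorm.comp_apply, smul_apply, NNReal.smul_def, Real.coe_toNNReal _ hC,
    ContinuousLinearMap.coe_coe, hiter, coe_normSeminorm, smul_eq_mul]
  rfl

lemma polyBounded_seminorm (k n : ℕ) :
    PolyBounded (SchwartzMap.seminorm 𝕜 k n : Seminorm 𝕜 𝓢(Space N, 𝕜)) := by
  choose T hT hderiv using fun I : Fin n → Fin N => exists_tame_iteratedLineDerivOp (𝕜 := 𝕜) I
  obtain ⟨R, hR, hpow⟩ := exists_tame_norm_sq_pow (N := N) (𝕜 := 𝕜) k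
  have hsum : PolyBounded (∑ I : Fin n → Fin N,
      ((SchwartzMap.seminorm 𝕜 0 0 : Seminorm 𝕜 𝓢(Space N, 𝕜)).comp (T I).toLinearMap +
        (SchwartzMap.seminorm 𝕜 0 0 : Seminorm 𝕜 𝓢(Space N, 𝕜)).comp (R * T I).toLinearMap)) :=
    PolyBounded.sum fun I _ => (hT I _ polyBounded_seminorm_zero).add
      (mul_mem hR (hT I) _ polyBounded_seminorm_zero)
  refine hsum.mono fun w =>
    (seminorm_le_sum_lineDeriv (EuclideanSpace.basisFun (Fin N) ℝ) k n w).trans_eq ?_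
  rw [_root_.sum_apply]
  refine Finset.sum_congr rfl fun I _ => ?_
  simp only [EuclideanSpace.basisFun_apply, hderiv, hpow]
  rfl

end PolynomialBounds

section Completeness

open SchwartzMap LineDeriv FourierTransform
open scoped InnerProductSpace ComplexConjugate

section MomentProblem

variable {E : Type*} [NormedAddCommGroup E] [InnerProductSpace ℝ E] [FiniteDimensional ℝ E]
  [MeasurableSpace E] [BorelSpace E] {v : E → ℂ}

lemma ae_eq_zero_of_fourier_eq_zero (hv : Integrable v) (h : ∀ t, 𝓕 v t = 0) :
    ∀ᵐ x, v x = 0 := by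
  refine ae_eq_zero_of_integral_contDiff_smul_eq_zero hv.locallyIntegrable fun g hg hgs => ?_
  let φ : 𝓢(E, ℂ) := HasCompactSupport.toSchwartzMap (f := fun x => ((g x : ℝ) : ℂ))
    (hgs.comp_left (g := fun r : ℝ => (r : ℂ)) (by simp)) (Complex.ofRealCLM.contDiff.comp hg)
  have hφ : VectorFourier.fourierIntegral Real.fourierChar volume (innerₗ E)
      (⇑(𝓕⁻ φ : 𝓢(E, ℂ))) = φ := by
    have hinv : 𝓕 (𝓕⁻ φ) = φ := FourierTransform.fourier_fourierInv_eq φ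
    exact congrArg (fun ψ : 𝓢(E, ℂ) => (ψ : E → ℂ)) hinv
  have hflip : ∀ x,
      VectorFourier.fourierIntegral Real.fourierChar volume (innerₗ E).flip v x = 0 := fun x => by
    rw [flip_innerₗ]
    exact h x
  have hparseval := VectorFourier.integral_fourierIntegral_smul_eq_flip (L := innerₗ E)
    Real.continuous_fourierChar continuous_inner (𝓕⁻ φ).integrable hv (μ := volume) (ν := volume)
  simp only [hφ, hflip, smul_zero, integral_zero] at hparseval
  exact hparseval

lemma hasSum_fourier_of_integrable_exp (hv : AEStronglyMeasurable v)
    (hexp : ∀ c : ℝ, Integrable fun x => Real.exp (c * ‖x‖) * ‖v x‖) (t : E) :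
    HasSum (fun k : ℕ => (-2 * Real.pi * Complex.I) ^ k / k.factorial *
      ∫ x, ((inner ℝ x t : ℝ) : ℂ) ^ k * v x) (𝓕 v t) := by
  have hnorm : ∀ x, ‖((-2 * Real.pi * inner ℝ x t : ℝ) : ℂ) * Complex.I‖ ≤
      2 * Real.pi * ‖t‖ * ‖x‖ := fun x => by
    rw [norm_mul, Complex.norm_I, mul_one, Complex.norm_real, norm_mul, norm_mul, norm_neg,
      Real.norm_ofNat, Real.norm_of_nonneg Real.pi_pos.le, mul_assoc _ ‖t‖, mul_comm ‖t‖]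
    gcongr
    exact norm_inner_le_norm x t
  have hterm : ∀ k : ℕ, (-2 * Real.pi * Complex.I) ^ k / k.factorial *
      ∫ x, ((inner ℝ x t : ℝ) : ℂ) ^ k * v x =
      ∫ x, ((-2 * Real.pi * inner ℝ x t : ℝ) * Complex.I) ^ k / k.factorial * v x := fun k => by
    rw [← integral_const_mul]
    congr 1 with x
    push_cast
    ring
  simp only [hterm, Real.fourier_eq']
  refine hasSum_integral_of_dominated_convergence
    (fun k x => (2 * Real.pi * ‖t‖ * ‖x‖) ^ k / k.factorial * ‖v x‖)
    (fun k => (Continuous.aestronglyMeasurable (by fun_prop)).mul hv)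
    (fun k => .of_forall fun x => ?_)
    (.of_forall fun x => (Real.summable_pow_div_factorial _).mul_right _)
    ((hexp (2 * Real.pi * ‖t‖)).congr (.of_forall fun x => ?_)) (.of_forall fun x => ?_)
  · rw [norm_mul, norm_div, norm_pow, Complex.norm_natCast]
    gcongr
    exact hnorm x
  · simp only
    rw [tsum_mul_right, Real.exp_eq_exp_ℝ, NormedSpace.exp_eq_tsum_div]
  · rw [Complex.exp_eq_exp_ℂ]
    exact (NormedSpace.expSeries_div_hasSum_exp _).mul_right (v x)

lemma ae_eq_zero_of_moments_eq_zero (hv : AEStronglyMeasurable v)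
    (hexp : ∀ c : ℝ, Integrable fun x => Real.exp (c * ‖x‖) * ‖v x‖)
    (h : ∀ (t : E) (k : ℕ), ∫ x, ((inner ℝ x t : ℝ) : ℂ) ^ k * v x = 0) : ∀ᵐ x, v x = 0 := by
  refine ae_eq_zero_of_fourier_eq_zero ((hexp 0).mono hv (.of_forall fun x => by simp)) fun t => ?_
  refine (hasSum_fourier_of_integrable_exp hv hexp t).unique ?_
  simp only [h, mul_zero]
  exact hasSum_zero

end MomentProblem

variable {N : ℕ} {𝕜 : Type*} [RCLike 𝕜]

lemma mulCoord_mem_iSup_hermiteSpace (i : Fin N) {w : 𝓢(Space N, 𝕜)}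
    (hw : w ∈ ⨆ n, hermiteSpace N 𝕜 n) :
    mulCoord i w ∈ ⨆ n, hermiteSpace N 𝕜 n := by
  refine Submodule.iSup_induction (hermiteSpace N 𝕜)
    (motive := fun w => mulCoord i w ∈ ⨆ n, hermiteSpace N 𝕜 n) hw (fun n v hv => ?_) (by simp)
    fun v w hv hw => by rw [map_add]; exact add_mem hv hw
  rw [mulCoord_eq_ladder]
  refine add_mem ?_ (Submodule.mem_iSup_of_mem (n + 1) (creat_mem_hermiteSpace i hv))
  rcases n with _ | n
  · rw [annih_of_mem_hermiteSpace_zero i hv]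
    exact zero_mem _
  · exact Submodule.mem_iSup_of_mem n (annih_mem_hermiteSpace i hv)

lemma exists_mem_iSup_hermiteSpace_inner_pow (t : Space N) (k : ℕ) :
    ∃ w ∈ ⨆ n, hermiteSpace N 𝕜 n,
      ∀ x, w x = ((inner ℝ x t ^ k * √(density N x) : ℝ) : 𝕜) := by
  induction k with
  | zero => exact ⟨ground N 𝕜, Submodule.mem_iSup_of_mem 0 ground_mem_hermiteSpace, fun x => by
      rw [ground_apply, pow_zero, one_mul]⟩
  | succ k ih =>
    obtain ⟨w, hw, hwx⟩ := ih
    refine ⟨∑ i, (t i : 𝕜) • mulCoord i w, sum_mem fun i _ =>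
      Submodule.smul_mem _ _ (mulCoord_mem_iSup_hermiteSpace i hw), fun x => ?_⟩
    have hinner : inner ℝ x t = ∑ i, t i * x i := by simp [PiLp.inner_apply]
    rw [_root_.sum_apply]
    simp only [smul_apply, mulCoord_apply, hwx, smul_eq_mul]
    rw [pow_succ', mul_assoc, RCLike.ofReal_mul (inner ℝ x t), hinner]
    simp only [RCLike.ofReal_sum, RCLike.ofReal_mul (t _), Finset.sum_mul]
    refine Finset.sum_congr rfl fun i _ => ?_
    ring

lemma integrable_conj_mul (w : 𝓢(Space N, 𝕜)) (u : FlatL2 N 𝕜) :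
    Integrable fun x => conj (w x) * u x :=
  MemLp.integrable_mul (p := 2) (q := 2) (w.memLp 2 volume).star (Lp.memLp u)

lemma integral_inner_pow_mul_sqrt_density (t : Space N) (k : ℕ) {u : FlatL2 N 𝕜}
    (h : ∀ w ∈ ⨆ n, hermiteSpace N 𝕜 n, ⟪embL2 N 𝕜 w, u⟫_𝕜 = 0) :
    ∫ x, ((inner ℝ x t : ℝ) : ℂ) ^ k * (√(density N x) • RCLike.map 𝕜 ℂ (u x)) = 0 := by
  obtain ⟨w, hw, hwx⟩ := exists_mem_iSup_hermiteSpace_inner_pow (𝕜 := 𝕜) t k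
  have hmap := (RCLike.map 𝕜 ℂ).integral_comp_comm (integrable_conj_mul w u)
  rw [← inner_embL2, h w hw, map_zero] at hmap
  rw [← hmap]
  congr 1 with x
  rw [hwx, RCLike.conj_ofReal, ← RCLike.real_smul_eq_coe_mul, map_smul, mul_smul]
  simp only [Complex.real_smul]
  push_cast
  rfl

lemma eq_zero_of_inner_hermiteSpace {u : FlatL2 N 𝕜}
    (h : ∀ n, ∀ w ∈ hermiteSpace N 𝕜 n, ⟪embL2 N 𝕜 w, u⟫_𝕜 = 0) : u = 0 := by
  have hspan : ∀ w ∈ ⨆ n, hermiteSpace N 𝕜 n, ⟪embL2 N 𝕜 w, u⟫_𝕜 = 0 := fun w hw =>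
    Submodule.iSup_induction (hermiteSpace N 𝕜) (motive := fun w => ⟪embL2 N 𝕜 w, u⟫_𝕜 = 0) hw h
      (by simp) fun v w hv hw => by rw [map_add, inner_add_left, hv, hw, add_zero]
  let v : Space N → ℂ := fun x => √(density N x) • RCLike.map 𝕜 ℂ (u x)
  have hmeas : AEStronglyMeasurable v volume :=
    (contDiff_sqrt_density N).continuous.aestronglyMeasurable.smul
      ((RCLike.map 𝕜 ℂ).continuous.comp_aestronglyMeasurable (Lp.aestronglyMeasurable u))
  have hnorm : ∀ x, ‖v x‖ = √(density N x) * ‖u x‖ := fun x => by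
    rw [norm_smul, norm_map_rclike, Real.norm_of_nonneg (Real.sqrt_nonneg _)]
  have hexp : ∀ c : ℝ, Integrable (fun x => Real.exp (c * ‖x‖) * ‖v x‖) volume := fun c =>
    ((memLp_exp_mul_sqrt_density c).integrable_mul (Lp.memLp u).norm).congr
      (.of_forall fun x => by simp only [Pi.mul_apply, hnorm, mul_assoc])
  have hv : ∀ᵐ x, v x = 0 := ae_eq_zero_of_moments_eq_zero hmeas hexp fun t k =>
    integral_inner_pow_mul_sqrt_density t k hspan
  refine Lp.eq_zero_iff_ae_eq_zero.2 ?_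
  filter_upwards [hv] with x hx
  have hsqrt : √(density N x) ≠ 0 := (Real.sqrt_pos.2 (density_pos N x)).ne'
  have hzero := hnorm x
  rw [hx, norm_zero] at hzero
  simpa [hsqrt] using hzero.symm

end Completeness

section Expansion

open SchwartzMap
open scoped InnerProductSpace ComplexConjugate

variable {N : ℕ} {𝕜 : Type*} [RCLike 𝕜]

lemma inner_hermiteSpace_eq_zero {m n : ℕ} (hmn : m ≠ n) {v w : 𝓢(Space N, 𝕜)}
    (hv : v ∈ hermiteSpace N 𝕜 m) (hw : w ∈ hermiteSpace N 𝕜 n) :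
    ⟪embL2 N 𝕜 v, embL2 N 𝕜 w⟫_𝕜 = 0 := by
  have hsymm := inner_number v w
  rw [number_of_mem_hermiteSpace hv, number_of_mem_hermiteSpace hw, map_smul, map_smul,
    inner_smul_left, inner_smul_right, map_natCast] at hsymm
  by_contra hne
  exact hmn (Nat.cast_injective (mul_right_cancel₀ hne hsymm))

/-- The orthogonal projection of `L²(dx)` onto the Hermite functions of degree `n`. -/
def hermiteProj (N : ℕ) (𝕜 : Type*) [RCLike 𝕜] (n : ℕ) : FlatL2 N 𝕜 →L[𝕜] FlatL2 N 𝕜 :=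
  ((hermiteSpace N 𝕜 n).map (embL2 N 𝕜).toLinearMap).starProjection

lemma exists_embL2_eq_hermiteProj (n : ℕ) (u : FlatL2 N 𝕜) :
    ∃ w ∈ hermiteSpace N 𝕜 n, embL2 N 𝕜 w = hermiteProj N 𝕜 n u :=
  Submodule.starProjection_apply_mem ((hermiteSpace N 𝕜 n).map (embL2 N 𝕜).toLinearMap) u

/-- The component of `u` in the Hermite space of degree `n`, as a Schwartz function. -/
def hermiteComp (n : ℕ) (u : FlatL2 N 𝕜) : 𝓢(Space N, 𝕜) :=
  (exists_embL2_eq_hermiteProj n u).choose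

lemma hermiteComp_mem_hermiteSpace (n : ℕ) (u : FlatL2 N 𝕜) :
    hermiteComp n u ∈ hermiteSpace N 𝕜 n :=
  (exists_embL2_eq_hermiteProj n u).choose_spec.1

lemma embL2_hermiteComp (n : ℕ) (u : FlatL2 N 𝕜) :
    embL2 N 𝕜 (hermiteComp n u) = hermiteProj N 𝕜 n u :=
  (exists_embL2_eq_hermiteProj n u).choose_spec.2

lemma inner_hermiteProj {n : ℕ} {w : 𝓢(Space N, 𝕜)} (hw : w ∈ hermiteSpace N 𝕜 n)
    (u : FlatL2 N 𝕜) : ⟪embL2 N 𝕜 w, hermiteProj N 𝕜 n u⟫_𝕜 = ⟪embL2 N 𝕜 w, u⟫_𝕜 := by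
  have h : embL2 N 𝕜 w ∈ (hermiteSpace N 𝕜 n).map (embL2 N 𝕜).toLinearMap :=
    Submodule.mem_map_of_mem hw
  rw [hermiteProj, ← Submodule.inner_starProjection_left_eq_right,
    Submodule.starProjection_eq_self_iff.2 h]

lemma inner_hermiteProj_of_ne {m n : ℕ} (hmn : m ≠ n) {w : 𝓢(Space N, 𝕜)}
    (hw : w ∈ hermiteSpace N 𝕜 m) (u : FlatL2 N 𝕜) :
    ⟪embL2 N 𝕜 w, hermiteProj N 𝕜 n u⟫_𝕜 = 0 := by
  rw [← embL2_hermiteComp]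
  exact inner_hermiteSpace_eq_zero hmn hw (hermiteComp_mem_hermiteSpace n u)

lemma norm_hermiteProj_le (n : ℕ) (u : FlatL2 N 𝕜) : ‖hermiteProj N 𝕜 n u‖ ≤ ‖u‖ :=
  Submodule.norm_starProjection_apply_le _ u

lemma norm_hermiteProj_le_one (n : ℕ) : ‖hermiteProj N 𝕜 n‖ ≤ 1 :=
  ContinuousLinearMap.opNorm_le_bound _ zero_le_one fun u => by
    rw [one_mul]; exact norm_hermiteProj_le n u

lemma ext_inner_hermiteSpace {u v : FlatL2 N 𝕜}
    (h : ∀ n, ∀ w ∈ hermiteSpace N 𝕜 n, ⟪embL2 N 𝕜 w, u⟫_𝕜 = ⟪embL2 N 𝕜 w, v⟫_𝕜) : u = v := by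
  rw [← sub_eq_zero]
  refine eq_zero_of_inner_hermiteSpace fun n w hw => ?_
  rw [inner_sub_right, h n w hw, sub_self]

lemma inner_of_hasSum_hermiteSpace {b : ℕ → 𝓢(Space N, 𝕜)} (hb : ∀ n, b n ∈ hermiteSpace N 𝕜 n)
    {u : FlatL2 N 𝕜} (hu : HasSum (fun n => embL2 N 𝕜 (b n)) u) {n : ℕ} {w : 𝓢(Space N, 𝕜)}
    (hw : w ∈ hermiteSpace N 𝕜 n) : ⟪embL2 N 𝕜 w, u⟫_𝕜 = ⟪embL2 N 𝕜 w, embL2 N 𝕜 (b n)⟫_𝕜 :=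
  (hu.mapL (innerSL 𝕜 (embL2 N 𝕜 w))).unique <| hasSum_single n fun m hm =>
    inner_hermiteSpace_eq_zero hm.symm hw (hb m)

lemma summable_one_add_pow_neg_two : Summable fun n : ℕ => ((1 + (n : ℝ)) ^ 2)⁻¹ := by
  refine ((summable_nat_add_iff 1).2 (Real.summable_nat_pow_inv.2 one_lt_two)).congr fun n => ?_
  push_cast
  rw [add_comm]

lemma summable_of_one_add_pow_mul_le {f : ℕ → ℝ} (hf : ∀ n, 0 ≤ f n) {C : ℝ}
    (h : ∀ n : ℕ, (1 + n : ℝ) ^ 2 * f n ≤ C) : Summable f :=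
  .of_nonneg_of_le hf (fun n => by
    rw [← div_eq_mul_inv, le_div_iff₀ (by positivity), mul_comm]
    exact h n) (summable_one_add_pow_neg_two.mul_left C)

lemma exists_hasSum_hermiteComp {u : FlatL2 N 𝕜}
    (hu : ∀ M : ℕ, ∃ C : ℝ, ∀ n : ℕ, (1 + n : ℝ) ^ M * ‖hermiteProj N 𝕜 n u‖ ≤ C) :
    ∃ ψ : 𝓢(Space N, 𝕜), embL2 N 𝕜 ψ = u ∧ HasSum (fun n => hermiteComp n u) ψ := by
  obtain ⟨ψ, hψ⟩ := exists_hasSum_of_summable_seminorm (fun n => hermiteComp n u) fun k l => by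
    obtain ⟨C, M, hC, hb⟩ := polyBounded_seminorm (N := N) (𝕜 := 𝕜) k l
    obtain ⟨C', hC'⟩ := hu (M + 2)
    refine summable_of_one_add_pow_mul_le (C := C * C') (fun n => apply_nonneg _ _) fun n => ?_
    calc (1 + n : ℝ) ^ 2 * SchwartzMap.seminorm ℝ k l (hermiteComp n u)
        ≤ (1 + n : ℝ) ^ 2 * (C * (1 + n) ^ M * ‖embL2 N 𝕜 (hermiteComp n u)‖) := by
          gcongr
          exact hb n _ (hermiteComp_mem_hermiteSpace n u)
      _ = C * ((1 + n : ℝ) ^ (M + 2) * ‖hermiteProj N 𝕜 n u‖) := by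
          rw [embL2_hermiteComp]
          ring
      _ ≤ C * C' := by gcongr; exact hC' n
  refine ⟨ψ, ext_inner_hermiteSpace fun n w hw => ?_, hψ⟩
  rw [inner_of_hasSum_hermiteSpace (hermiteComp_mem_hermiteSpace · u) (hψ.mapL (embL2 N 𝕜)) hw,
    embL2_hermiteComp, inner_hermiteProj hw]

/-- The operator `1 + H`, with `H` the number operator. -/
def oneAddNumber (N : ℕ) (𝕜 : Type*) [RCLike 𝕜] : 𝓢(Space N, 𝕜) →L[𝕜] 𝓢(Space N, 𝕜) :=
  1 + number N 𝕜

lemma inner_oneAddNumber_pow (k : ℕ) (φ ψ : 𝓢(Space N, 𝕜)) :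
    ⟪embL2 N 𝕜 ((oneAddNumber N 𝕜 ^ k) φ), embL2 N 𝕜 ψ⟫_𝕜 =
      ⟪embL2 N 𝕜 φ, embL2 N 𝕜 ((oneAddNumber N 𝕜 ^ k) ψ)⟫_𝕜 := by
  induction k generalizing φ with
  | zero => simp
  | succ k ih =>
    rw [pow_succ, mul_apply_eq_comp, ih, ← pow_succ, pow_succ', mul_apply_eq_comp]
    simp only [oneAddNumber, add_apply, one_apply_eq_self, map_add, inner_add_left,
      inner_add_right, inner_number]

lemma oneAddNumber_pow_of_mem_hermiteSpace (k : ℕ) {n : ℕ} {w : 𝓢(Space N, 𝕜)}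
    (hw : w ∈ hermiteSpace N 𝕜 n) :
    (oneAddNumber N 𝕜 ^ k) w = (((1 + n : ℝ) ^ k : ℝ) : 𝕜) • w := by
  induction k with
  | zero => simp
  | succ k ih =>
    rw [pow_succ', mul_apply_eq_comp, ih, map_smul, pow_succ]
    have hone : oneAddNumber N 𝕜 w = ((1 + n : ℝ) : 𝕜) • w := by
      change w + number N 𝕜 w = _
      rw [number_of_mem_hermiteSpace hw]
      push_cast
      rw [add_smul, one_smul]
    rw [hone, smul_smul, RCLike.ofReal_mul]

lemma hermiteProj_oneAddNumber_pow (k n : ℕ) (ψ : 𝓢(Space N, 𝕜)) :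
    hermiteProj N 𝕜 n (embL2 N 𝕜 ((oneAddNumber N 𝕜 ^ k) ψ)) =
      (((1 + n : ℝ) ^ k : ℝ) : 𝕜) • hermiteProj N 𝕜 n (embL2 N 𝕜 ψ) := by
  refine ext_inner_hermiteSpace fun m w hw => ?_
  rw [inner_smul_right]
  obtain rfl | hmn := eq_or_ne m n
  · rw [inner_hermiteProj hw, inner_hermiteProj hw, ← inner_oneAddNumber_pow,
      oneAddNumber_pow_of_mem_hermiteSpace k hw, map_smul, inner_smul_left, RCLike.conj_ofReal]
  · rw [inner_hermiteProj_of_ne hmn hw, inner_hermiteProj_of_ne hmn hw, mul_zero]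

lemma norm_hermiteProj_embL2_le (k n : ℕ) (ψ : 𝓢(Space N, 𝕜)) :
    (1 + n : ℝ) ^ k * ‖hermiteProj N 𝕜 n (embL2 N 𝕜 ψ)‖ ≤
      ‖embL2 N 𝕜 ((oneAddNumber N 𝕜 ^ k) ψ)‖ := by
  refine le_of_eq_of_le ?_ (norm_hermiteProj_le n _)
  rw [hermiteProj_oneAddNumber_pow, norm_smul, RCLike.norm_ofReal, abs_of_nonneg (by positivity)]

lemma hasSum_hermiteComp (ψ : 𝓢(Space N, 𝕜)) :
    HasSum (fun n => hermiteComp n (embL2 N 𝕜 ψ)) ψ := by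
  obtain ⟨φ, hφ, hs⟩ := exists_hasSum_hermiteComp (u := embL2 N 𝕜 ψ) fun M =>
    ⟨_, fun n => norm_hermiteProj_embL2_le M n ψ⟩
  rwa [embL2_injective hφ] at hs

/-- The function `m(H)` of the number operator `H`, for summable `m`. -/
def multiplier (N : ℕ) (𝕜 : Type*) [RCLike 𝕜] (m : ℕ → ℝ) : FlatL2 N 𝕜 →L[𝕜] FlatL2 N 𝕜 :=
  ∑' n, (m n : 𝕜) • hermiteProj N 𝕜 n

lemma inner_multiplier {m : ℕ → ℝ} (hm : Summable m) (u : FlatL2 N 𝕜) {n : ℕ}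
    {w : 𝓢(Space N, 𝕜)} (hw : w ∈ hermiteSpace N 𝕜 n) :
    ⟪embL2 N 𝕜 w, multiplier N 𝕜 m u⟫_𝕜 = (m n : 𝕜) * ⟪embL2 N 𝕜 w, u⟫_𝕜 := by
  have hsummable : Summable fun n => (m n : 𝕜) • hermiteProj N 𝕜 n :=
    .of_norm_bounded hm.norm fun n => by
      rw [norm_smul, RCLike.norm_ofReal, Real.norm_eq_abs]
      exact mul_le_of_le_one_right (abs_nonneg _) (norm_hermiteProj_le_one n)
  have happly : HasSum (fun n => embL2 N 𝕜 ((m n : 𝕜) • hermiteComp n u))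
      (multiplier N 𝕜 m u) := by
    simp only [map_smul, embL2_hermiteComp]
    exact hsummable.hasSum.mapL (ContinuousLinearMap.apply 𝕜 (FlatL2 N 𝕜) u)
  rw [inner_of_hasSum_hermiteSpace
      (fun n => Submodule.smul_mem _ _ (hermiteComp_mem_hermiteSpace n u)) happly hw,
    map_smul, inner_smul_right, embL2_hermiteComp, inner_hermiteProj hw]

end Expansion

section Transfer

open SchwartzMap
open scoped InnerProductSpace ComplexConjugate ENNReal

variable {N : ℕ} {𝕜 : Type*} [RCLike 𝕜]

lemma sqrt_density_pos (x : Space N) : 0 < √(density N x) :=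
  Real.sqrt_pos.2 (density_pos N x)

lemma measurable_density (N : ℕ) : Measurable fun x => ENNReal.ofReal (density N x) :=
  (contDiff_density N).continuous.measurable.ennreal_ofReal

lemma gaussian_absolutelyContinuous (N : ℕ) : gaussian N ≪ volume :=
  withDensity_absolutelyContinuous _ _

lemma volume_absolutelyContinuous (N : ℕ) : (volume : Measure (Space N)) ≪ gaussian N :=
  withDensity_absolutelyContinuous' (measurable_density N).aemeasurable
    (.of_forall fun x => by simpa using density_pos N x)

lemma integral_gaussian (f : Space N → 𝕜) :
    ∫ x, f x ∂(gaussian N) = ∫ x, density N x • f x := by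
  rw [gaussian, integral_withDensity_eq_integral_toReal_smul (measurable_density N)
    (.of_forall fun x => ENNReal.ofReal_lt_top)]
  simp only [ENNReal.toReal_ofReal (density_pos N _).le]

lemma eLpNorm_gaussian (f : Space N → 𝕜) :
    eLpNorm f 2 (gaussian N) = eLpNorm (fun x => √(density N x) • f x) 2 volume := by
  rw [eLpNorm_eq_lintegral_rpow_enorm_toReal two_ne_zero ENNReal.ofNat_ne_top,
    eLpNorm_eq_lintegral_rpow_enorm_toReal two_ne_zero ENNReal.ofNat_ne_top, gaussian,
    lintegral_withDensity_eq_lintegral_mul_non_measurable _ (measurable_density N)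
      (.of_forall fun x => ENNReal.ofReal_lt_top)]
  congr 2
  ext x
  rw [Pi.mul_apply, enorm_smul, ENNReal.mul_rpow_of_nonneg _ _ (by simp)]
  congr 1
  rw [Real.enorm_of_nonneg (Real.sqrt_nonneg _), ENNReal.ofReal_rpow_of_nonneg (Real.sqrt_nonneg _)
    (by simp)]
  congr 1
  simp [Real.sq_sqrt (density_pos N x).le]

lemma memLp_flat (f : L2 N 𝕜) :
    MemLp (fun x => √(density N x) • f x) 2 (volume : Measure (Space N)) := by
  refine ⟨(contDiff_sqrt_density N).continuous.aestronglyMeasurable.smul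
    ((Lp.aestronglyMeasurable f).mono_ac (volume_absolutelyContinuous N)), ?_⟩
  rw [← eLpNorm_gaussian]
  exact Lp.eLpNorm_lt_top f

/-- Multiplication `f ↦ (p^N)^{1/2} f` as an isometry of `L²(μ^N)` into `L²(dx)`. -/
def flatIsometry (N : ℕ) (𝕜 : Type*) [RCLike 𝕜] : L2 N 𝕜 →ₗᵢ[𝕜] FlatL2 N 𝕜 where
  toFun f := (memLp_flat f).toLp
  map_add' f g := by
    rw [← MemLp.toLp_add]
    refine MemLp.toLp_congr _ _ ?_
    filter_upwards [(volume_absolutelyContinuous N).ae_eq (Lp.coeFn_add f g)] with x hx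
    rw [hx]
    exact smul_add _ _ _
  map_smul' c f := by
    rw [RingHom.id_apply, ← MemLp.toLp_const_smul]
    refine MemLp.toLp_congr _ _ ?_
    filter_upwards [(volume_absolutelyContinuous N).ae_eq (Lp.coeFn_smul c f)] with x hx
    rw [hx]
    exact smul_comm √(density N x) c (f x)
  norm_map' f := by
    change ‖(memLp_flat f).toLp‖ = _
    rw [Lp.norm_toLp, ← eLpNorm_gaussian, Lp.norm_def]

lemma flatIsometry_surjective : Function.Surjective (flatIsometry N 𝕜) := by
  intro u
  have hcancel : (fun x => √(density N x) • ((√(density N x))⁻¹ • u x)) = u := by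
    ext x
    rw [smul_smul, mul_inv_cancel₀ (sqrt_density_pos x).ne', one_smul]
  have hquot : MemLp (fun x => (√(density N x))⁻¹ • u x) 2 (gaussian N) := by
    refine ⟨((contDiff_sqrt_density N).continuous.inv₀
      fun x => (sqrt_density_pos x).ne').aestronglyMeasurable.smul
      ((Lp.aestronglyMeasurable u).mono_ac (gaussian_absolutelyContinuous N)), ?_⟩
    rw [eLpNorm_gaussian, hcancel]
    exact Lp.eLpNorm_lt_top u
  refine ⟨hquot.toLp, Lp.ext ?_⟩
  filter_upwards [(memLp_flat hquot.toLp).coeFn_toLp,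
    (volume_absolutelyContinuous N).ae_eq hquot.coeFn_toLp] with x hx hx'
  refine hx.trans ?_
  rw [hx']
  exact congrFun hcancel x

/-- The unitary equivalence `f ↦ (p^N)^{1/2} f` of `L²(μ^N)` and `L²(dx)`. -/
def flat (N : ℕ) (𝕜 : Type*) [RCLike 𝕜] : L2 N 𝕜 ≃ₗᵢ[𝕜] FlatL2 N 𝕜 :=
  .ofSurjective (flatIsometry N 𝕜) flatIsometry_surjective

lemma coeFn_flat (f : L2 N 𝕜) : flat N 𝕜 f =ᵐ[volume] fun x => √(density N x) • f x :=
  (memLp_flat f).coeFn_toLp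

/-- Division `φ ↦ (p^N)^{-1/2} φ` of test functions. -/
def divSqrtTest (φ : Test N) : Test N where
  toFun := fun x => (√(density N x))⁻¹ * φ x
  contDiff' := ((contDiff_sqrt_density N).inv fun x => (sqrt_density_pos x).ne').mul φ.contDiff
  hasCompactSupport' := φ.hasCompactSupport.mul_left
  tsupport_subset' := fun _ _ => trivial

lemma mulSqrtTest_apply (φ : Test N) (x : Space N) :
    mulSqrtTest N φ x = √(density N x) * φ x := rfl

lemma divSqrtTest_apply (φ : Test N) (x : Space N) :
    divSqrtTest φ x = (√(density N x))⁻¹ * φ x := rfl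

lemma mulSqrtTest_divSqrtTest (φ : Test N) : mulSqrtTest N (divSqrtTest φ) = φ := by
  ext x
  rw [mulSqrtTest_apply, divSqrtTest_apply, mul_inv_cancel_left₀ (sqrt_density_pos x).ne']

lemma testToSchwartz_apply (φ : Test N) (x : Space N) : testToSchwartz 𝕜 φ x = ((φ x : ℝ) : 𝕜) :=
  rfl

lemma inner_testToSchwartz (φ : Test N) (u : FlatL2 N 𝕜) :
    ⟪embL2 N 𝕜 (testToSchwartz 𝕜 φ), u⟫_𝕜 = ∫ x, φ x • u x := by
  rw [inner_embL2]
  congr 1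
  ext x
  rw [testToSchwartz_apply, RCLike.conj_ofReal, RCLike.real_smul_eq_coe_mul]

lemma integral_smul_eq_inner (φ : Test N) (f : L2 N 𝕜) :
    ∫ x, φ x • f x = ⟪embL2 N 𝕜 (testToSchwartz 𝕜 (divSqrtTest φ)), flat N 𝕜 f⟫_𝕜 := by
  rw [inner_testToSchwartz]
  refine integral_congr_ae ?_
  filter_upwards [coeFn_flat f] with x hx
  rw [hx, divSqrtTest_apply, smul_smul, mul_right_comm,
    inv_mul_cancel₀ (sqrt_density_pos x).ne', one_mul]

lemma integral_gaussian_smul_eq_inner (φ : Test N) (f : L2 N 𝕜) :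
    ∫ x, φ x • f x ∂(gaussian N) =
      ⟪embL2 N 𝕜 (testToSchwartz 𝕜 (mulSqrtTest N φ)), flat N 𝕜 f⟫_𝕜 := by
  rw [inner_testToSchwartz, integral_gaussian]
  refine integral_congr_ae ?_
  filter_upwards [coeFn_flat f] with x hx
  rw [hx, mulSqrtTest_apply, smul_smul, smul_smul, mul_right_comm,
    Real.mul_self_sqrt (density_pos N x).le]

lemma fderiv_ofReal_apply {g : Space N → ℝ} {x : Space N} (hg : DifferentiableAt ℝ g x)
    (v : Space N) : fderiv ℝ (fun y => (g y : 𝕜)) x v = (fderiv ℝ g x v : 𝕜) := by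
  have hcomp : HasFDerivAt (fun y => (g y : 𝕜))
      ((RCLike.ofRealCLM (K := 𝕜)).comp (fderiv ℝ g x)) x :=
    (RCLike.ofRealCLM (K := 𝕜)).hasFDerivAt.comp x hg.hasFDerivAt
  rw [hcomp.fderiv]
  rfl

lemma contDiff_partialDeriv {g : Space N → ℝ} (hg : ContDiff ℝ ∞ g) (i : Fin N) :
    ContDiff ℝ ∞ (partialDeriv i g) :=
  (hg.fderiv_right (m := ∞) (by simp)).clm_apply contDiff_const

lemma annih_sqrt_density_mul_ofReal (i : Fin N) (ψ : 𝓢(Space N, 𝕜)) {g : Space N → ℝ}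
    (hg : ContDiff ℝ ∞ g) (h : ∀ y, ψ y = (√(density N y) : 𝕜) * (g y : 𝕜))
    (x : Space N) :
    annih i ψ x = (√(density N x) : 𝕜) * (partialDeriv i g x : 𝕜) := by
  have hd : DifferentiableAt ℝ g x := (hg.differentiable (by simp)).differentiableAt
  rw [annih_sqrt_density_mul i ψ (fun y => ((g y : ℝ) : 𝕜)) x
    ((RCLike.ofRealCLM (K := 𝕜)).differentiableAt.comp x hd) h, fderiv_ofReal_apply hd]
  rfl

lemma number_mulSqrtTest (φ : Test N) (x : Space N) :
    number N 𝕜 (testToSchwartz 𝕜 (mulSqrtTest N φ)) x =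
      (√(density N x) : 𝕜) * (ornsteinUhlenbeck φ x : 𝕜) := by
  have hφ : ContDiff ℝ ∞ φ := φ.contDiff
  have hannih := fun i => annih_sqrt_density_mul_ofReal i
    (testToSchwartz 𝕜 (mulSqrtTest N φ)) hφ fun y => by
      rw [testToSchwartz_apply, mulSqrtTest_apply, RCLike.ofReal_mul]
  have hannih_annih := fun i => annih_sqrt_density_mul_ofReal i
    (annih i (testToSchwartz 𝕜 (mulSqrtTest N φ))) (contDiff_partialDeriv hφ i) (hannih i)
  have hcreat : ∀ (i : Fin N) (χ : 𝓢(Space N, 𝕜)),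
      creat i χ x = (x i : 𝕜) * χ x - annih i χ x := fun i χ => by
    rw [← mulCoord_apply, mulCoord_eq_ladder, add_apply, add_sub_cancel_left]
  rw [number_apply, _root_.sum_apply]
  simp only [hcreat, hannih, hannih_annih, ornsteinUhlenbeck]
  push_cast
  rw [mul_add, mul_neg, Finset.mul_sum, Finset.mul_sum, ← Finset.sum_neg_distrib,
    ← Finset.sum_add_distrib]
  refine Finset.sum_congr rfl fun i _ => ?_
  ring

lemma integral_ornsteinUhlenbeck (φ : Test N) (f : L2 N 𝕜) :
    ∫ x, ornsteinUhlenbeck φ x • f x ∂(gaussian N) =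
      ⟪embL2 N 𝕜 (number N 𝕜 (testToSchwartz 𝕜 (mulSqrtTest N φ))), flat N 𝕜 f⟫_𝕜 := by
  rw [inner_embL2, integral_gaussian]
  refine integral_congr_ae ?_
  filter_upwards [coeFn_flat f] with x hx
  rw [hx, number_mulSqrtTest, map_mul, RCLike.conj_ofReal, RCLike.conj_ofReal]
  simp only [RCLike.real_smul_eq_coe_mul]
  nth_rewrite 1 [← Real.mul_self_sqrt (density_pos N x).le]
  push_cast
  ring

lemma isOU_iff {f g : L2 N 𝕜} : IsOU f g ↔ ∀ φ : Test N,
    ⟪embL2 N 𝕜 (number N 𝕜 (testToSchwartz 𝕜 φ)), flat N 𝕜 f⟫_𝕜 =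
      ⟪embL2 N 𝕜 (testToSchwartz 𝕜 φ), flat N 𝕜 g⟫_𝕜 := by
  simp only [IsOU, integral_ornsteinUhlenbeck, integral_gaussian_smul_eq_inner]
  refine ⟨fun h φ => ?_, fun h φ => h _⟩
  simpa only [mulSqrtTest_divSqrtTest] using h (divSqrtTest φ)

lemma exists_test_add_I_smul (ψ : 𝓢(Space N, 𝕜)) (hψ : HasCompactSupport ψ) :
    ∃ φ χ : Test N, ψ = testToSchwartz 𝕜 φ + (RCLike.I : 𝕜) • testToSchwartz 𝕜 χ := by
  refine ⟨⟨fun x => RCLike.re (ψ x), (RCLike.reCLM (K := 𝕜)).contDiff.comp (ψ.smooth ⊤),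
    hψ.comp_left (map_zero _), fun _ _ => trivial⟩,
    ⟨fun x => RCLike.im (ψ x), (RCLike.imCLM (K := 𝕜)).contDiff.comp (ψ.smooth ⊤),
    hψ.comp_left (map_zero _), fun _ _ => trivial⟩, ?_⟩
  ext x
  rw [add_apply, smul_apply, testToSchwartz_apply, testToSchwartz_apply, smul_eq_mul, mul_comm]
  exact (RCLike.re_add_im (ψ x)).symm

lemma inner_eq_of_forall_test (S T : 𝓢(Space N, 𝕜) →L[𝕜] FlatL2 N 𝕜) {u v : FlatL2 N 𝕜}
    (h : ∀ φ : Test N, ⟪S (testToSchwartz 𝕜 φ), u⟫_𝕜 = ⟪T (testToSchwartz 𝕜 φ), v⟫_𝕜)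
    (ψ : 𝓢(Space N, 𝕜)) : ⟪S ψ, u⟫_𝕜 = ⟪T ψ, v⟫_𝕜 := by
  have hcont : ∀ (R : 𝓢(Space N, 𝕜) →L[𝕜] FlatL2 N 𝕜) (w : FlatL2 N 𝕜),
      Continuous fun ψ => ⟪R ψ, w⟫_𝕜 := fun R w => R.continuous.inner continuous_const
  refine congrFun ((hcont S u).ext_on dense_setOf_hasCompactSupport (hcont T v) fun φ hφ => ?_) ψ
  obtain ⟨α, β, hαβ⟩ := exists_test_add_I_smul φ hφ
  simp only [hαβ, map_add, map_smul, inner_add_left, inner_smul_left, h]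

lemma IsOU.inner_number {f g : L2 N 𝕜} (h : IsOU f g) (ψ : 𝓢(Space N, 𝕜)) :
    ⟪embL2 N 𝕜 (number N 𝕜 ψ), flat N 𝕜 f⟫_𝕜 = ⟪embL2 N 𝕜 ψ, flat N 𝕜 g⟫_𝕜 :=
  inner_eq_of_forall_test ((embL2 N 𝕜).comp (number N 𝕜)) (embL2 N 𝕜) (isOU_iff.1 h) ψ

lemma isOU_of_flat_eq {n : ℕ} {w : 𝓢(Space N, 𝕜)} (hw : w ∈ hermiteSpace N 𝕜 n) {f : L2 N 𝕜}
    (hf : flat N 𝕜 f = embL2 N 𝕜 w) : IsOU f (((n : ℝ) : 𝕜) • f) := by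
  rw [isOU_iff]
  intro φ
  rw [map_smul, hf, DiscreteWiener.inner_number, number_of_mem_hermiteSpace hw, map_smul,
    RCLike.ofReal_natCast]

lemma IsOU.inner_hermiteSpace_eq_zero {r : ℝ} {f : L2 N 𝕜} (h : IsOU f ((r : 𝕜) • f)) {n : ℕ}
    (hn : r ≠ n) {w : 𝓢(Space N, 𝕜)} (hw : w ∈ hermiteSpace N 𝕜 n) :
    ⟪embL2 N 𝕜 w, flat N 𝕜 f⟫_𝕜 = 0 := by
  have hsymm := h.inner_number w
  rw [number_of_mem_hermiteSpace hw, map_smul, inner_smul_left, map_natCast, map_smul,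
    inner_smul_right] at hsymm
  by_contra hne
  exact hn (by exact_mod_cast (mul_right_cancel₀ hne hsymm).symm)

lemma IsOU.eq_zero_or_exists {r : ℝ} {f : L2 N 𝕜} (h : IsOU f ((r : 𝕜) • f)) :
    f = 0 ∨ ∃ n : ℕ, r = n ∧ ∃ w ∈ hermiteSpace N 𝕜 n, flat N 𝕜 f = embL2 N 𝕜 w := by
  by_cases hr : ∃ n : ℕ, r = n
  · obtain ⟨n, rfl⟩ := hr
    refine .inr ⟨n, rfl, hermiteComp n (flat N 𝕜 f), hermiteComp_mem_hermiteSpace n _,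
      ext_inner_hermiteSpace fun m w hw => ?_⟩
    rw [embL2_hermiteComp]
    obtain rfl | hmn := eq_or_ne m n
    · rw [inner_hermiteProj hw]
    · rw [inner_hermiteProj_of_ne hmn hw,
        h.inner_hermiteSpace_eq_zero (Nat.cast_injective.ne hmn.symm) hw]
  · push Not at hr
    exact .inl <| (flat N 𝕜).map_eq_zero_iff.1 <| eq_zero_of_inner_hermiteSpace fun n w hw =>
      h.inner_hermiteSpace_eq_zero (hr n) hw

lemma isOUPower_iff {s : ℝ} {f g : L2 N 𝕜} : IsOUPower s f g ↔
    ∀ n : ℕ, ∀ w ∈ hermiteSpace N 𝕜 n, ⟪embL2 N 𝕜 w, flat N 𝕜 g⟫_𝕜 =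
      (((1 + n : ℝ) ^ (s / 2) : ℝ) : 𝕜) * ⟪embL2 N 𝕜 w, flat N 𝕜 f⟫_𝕜 := by
  refine ⟨fun h n w hw => ?_, fun h r e he => ?_⟩
  · have hflat : flat N 𝕜 ((flat N 𝕜).symm (embL2 N 𝕜 w)) = embL2 N 𝕜 w :=
      (flat N 𝕜).apply_symm_apply _
    rw [← hflat, LinearIsometryEquiv.inner_map_map, LinearIsometryEquiv.inner_map_map]
    exact h n _ (isOU_of_flat_eq hw hflat)
  · obtain rfl | ⟨n, rfl, w, hw, hew⟩ := he.eq_zero_or_exists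
    · simp
    · rw [← LinearIsometryEquiv.inner_map_map (flat N 𝕜), hew, h n w hw, ← hew,
        LinearIsometryEquiv.inner_map_map]

end Transfer

section Characterization

open SchwartzMap
open scoped InnerProductSpace ComplexConjugate

variable {N : ℕ} {𝕜 : Type*} [RCLike 𝕜]

lemma divSqrtTest_mulSqrtTest (φ : Test N) : divSqrtTest (mulSqrtTest N φ) = φ := by
  ext x
  rw [divSqrtTest_apply, mulSqrtTest_apply, inv_mul_cancel_left₀ (sqrt_density_pos x).ne']

lemma mulSqrt_apply (X : Distr N 𝕜) (φ : Test N) : mulSqrt X φ = X (mulSqrtTest N φ) := rfl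

lemma apply_eq_mulSqrt (X : Distr N 𝕜) (φ : Test N) : X φ = mulSqrt X (divSqrtTest φ) := by
  rw [mulSqrt_apply, mulSqrtTest_divSqrtTest]

lemma inner_testToSchwartz_embL2 (φ : Test N) (ψ : 𝓢(Space N, 𝕜)) :
    ⟪embL2 N 𝕜 (testToSchwartz 𝕜 φ), embL2 N 𝕜 ψ⟫_𝕜 = ∫ x, φ x • ψ x := by
  rw [inner_testToSchwartz]
  refine integral_congr_ae ?_
  filter_upwards [coeFn_embL2 ψ] with x hx
  rw [hx]

lemma isOUPower_of_mem_hermiteSpace (s : ℝ) {n : ℕ} {w : 𝓢(Space N, 𝕜)}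
    (hw : w ∈ hermiteSpace N 𝕜 n) :
    IsOUPower s ((flat N 𝕜).symm (embL2 N 𝕜 w))
      ((((1 + n : ℝ) ^ (s / 2) : ℝ) : 𝕜) • (flat N 𝕜).symm (embL2 N 𝕜 w)) := by
  refine isOUPower_iff.2 fun m v hv => ?_
  rw [map_smul, LinearIsometryEquiv.apply_symm_apply, inner_smul_right]
  obtain rfl | hmn := eq_or_ne m n
  · rfl
  · rw [inner_hermiteSpace_eq_zero hmn hv hw, mul_zero, mul_zero]

lemma IsOUPower.sum {ι : Type*} {s : ℝ} {f g : ι → L2 N 𝕜} (h : ∀ i, IsOUPower s (f i) (g i))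
    (t : Finset ι) : IsOUPower s (∑ i ∈ t, f i) (∑ i ∈ t, g i) := fun r e he => by
  rw [inner_sum, inner_sum, Finset.mul_sum]
  exact Finset.sum_congr rfl fun i _ => h i r e he

lemma mem_sobolev_of_hasSum {X : Distr N 𝕜} {s : ℝ} {b : ℕ → 𝓢(Space N, 𝕜)}
    (hb : ∀ n, b n ∈ hermiteSpace N 𝕜 n)
    (hsum : Summable fun n : ℕ => (1 + n : ℝ) ^ (s / 2) * ‖embL2 N 𝕜 (b n)‖)
    (hX : ∀ φ : Test N, HasSum
      (fun n => ⟪embL2 N 𝕜 (testToSchwartz 𝕜 φ), embL2 N 𝕜 (b n)⟫_𝕜) (mulSqrt X φ)) :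
    X ∈ sobolev N 𝕜 s := by
  let f n := (flat N 𝕜).symm (embL2 N 𝕜 (b n))
  let g (n : ℕ) := (((1 + n : ℝ) ^ (s / 2) : ℝ) : 𝕜) • f n
  have hg : Summable g := .of_norm_bounded hsum fun n => by
    rw [norm_smul, RCLike.norm_ofReal, abs_of_nonneg (by positivity),
      LinearIsometryEquiv.norm_map]
  refine ⟨fun K => ∑ n ∈ Finset.range K, f n, fun K => ∑ n ∈ Finset.range K, g n,
    fun K => IsOUPower.sum (fun n => isOUPower_of_mem_hermiteSpace s (hb n)) _,
    hg.hasSum.tendsto_sum_nat.cauchySeq, fun φ => ?_⟩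
  simpa only [integral_smul_eq_inner, map_sum, inner_sum, f, LinearIsometryEquiv.apply_symm_apply,
    ← apply_eq_mulSqrt] using (hX (divSqrtTest φ)).tendsto_sum_nat

lemma mem_sobolev_of_isSchwartz {X : Distr N 𝕜} (hX : IsSchwartz (mulSqrt X)) (s : ℝ) :
    X ∈ sobolev N 𝕜 s := by
  obtain ⟨ψ, hψ⟩ := hX
  obtain ⟨k, hk⟩ := exists_nat_ge (s / 2)
  have hsum : Summable fun n : ℕ =>
      (1 + n : ℝ) ^ (s / 2) * ‖embL2 N 𝕜 (hermiteComp n (embL2 N 𝕜 ψ))‖ := by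
    refine summable_of_one_add_pow_mul_le (C := ‖embL2 N 𝕜 ((oneAddNumber N 𝕜 ^ (k + 2)) ψ)‖)
      (fun n => by positivity) fun n => ?_
    have hpow : (1 + n : ℝ) ^ (s / 2) ≤ (1 + n : ℝ) ^ k := by
      rw [← Real.rpow_natCast]
      exact Real.rpow_le_rpow_of_exponent_le (by simp) hk
    calc _ ≤ (1 + n : ℝ) ^ 2 *
          ((1 + n : ℝ) ^ k * ‖embL2 N 𝕜 (hermiteComp n (embL2 N 𝕜 ψ))‖) := by gcongr
      _ = (1 + n : ℝ) ^ (k + 2) * ‖hermiteProj N 𝕜 n (embL2 N 𝕜 ψ)‖ := by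
          rw [embL2_hermiteComp]
          ring
      _ ≤ _ := norm_hermiteProj_embL2_le (k + 2) n ψ
  refine mem_sobolev_of_hasSum (fun n => hermiteComp_mem_hermiteSpace n _) hsum fun φ => ?_
  rw [hψ, ← inner_testToSchwartz_embL2]
  exact (hasSum_hermiteComp ψ).mapL ((innerSL 𝕜 (embL2 N 𝕜 (testToSchwartz 𝕜 φ))).comp (embL2 N 𝕜))

lemma summable_one_add_rpow {p : ℝ} (hp : p < -1) : Summable fun n : ℕ => (1 + n : ℝ) ^ p := by
  refine ((summable_nat_add_iff 1).2 (Real.summable_nat_rpow.2 hp)).congr fun n => ?_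
  push_cast
  rw [add_comm]

lemma inner_eq_of_forall_hermiteSpace (S T : 𝓢(Space N, 𝕜) →L[𝕜] FlatL2 N 𝕜) {u v : FlatL2 N 𝕜}
    (h : ∀ n, ∀ w ∈ hermiteSpace N 𝕜 n, ⟪S w, u⟫_𝕜 = ⟪T w, v⟫_𝕜) (ψ : 𝓢(Space N, 𝕜)) :
    ⟪S ψ, u⟫_𝕜 = ⟪T ψ, v⟫_𝕜 := by
  have hsum : ∀ (R : 𝓢(Space N, 𝕜) →L[𝕜] FlatL2 N 𝕜) (w : FlatL2 N 𝕜),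
      HasSum (fun n => ⟪R (hermiteComp n (embL2 N 𝕜 ψ)), w⟫_𝕜) ⟪R ψ, w⟫_𝕜 := fun R w =>
    ((hasSum_hermiteComp ψ).mapL R).mapL (innerSLFlip 𝕜 w)
  refine (hsum S u).unique ?_
  simpa only [h _ _ (hermiteComp_mem_hermiteSpace _ _)] using hsum T v

lemma IsOUPower.inner_eq_inner_multiplier {s : ℝ} {f g : L2 N 𝕜} (hfg : IsOUPower s f g) {k : ℕ}
    (hk : 1 < s / 2 + k) (ψ : 𝓢(Space N, 𝕜)) :
    ⟪embL2 N 𝕜 ψ, flat N 𝕜 f⟫_𝕜 = ⟪embL2 N 𝕜 ((oneAddNumber N 𝕜 ^ k) ψ),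
      multiplier N 𝕜 (fun n => (1 + n : ℝ) ^ (-(s / 2) - k)) (flat N 𝕜 g)⟫_𝕜 := by
  refine inner_eq_of_forall_hermiteSpace (embL2 N 𝕜) ((embL2 N 𝕜).comp (oneAddNumber N 𝕜 ^ k))
    (fun n w hw => ?_) ψ
  have hweight : (1 + n : ℝ) ^ k * (1 + n : ℝ) ^ (-(s / 2) - k) * (1 + n : ℝ) ^ (s / 2) = 1 := by
    have hpos : (0 : ℝ) < 1 + n := by positivity
    rw [← Real.rpow_natCast, ← Real.rpow_add hpos, ← Real.rpow_add hpos]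
    simp
  rw [ContinuousLinearMap.comp_apply, oneAddNumber_pow_of_mem_hermiteSpace k hw, map_smul,
    inner_smul_left, RCLike.conj_ofReal,
    inner_multiplier (summable_one_add_rpow (by linarith)) _ hw, isOUPower_iff.1 hfg n w hw,
    ← mul_assoc, ← mul_assoc, ← RCLike.ofReal_mul, ← RCLike.ofReal_mul, hweight,
    RCLike.ofReal_one, one_mul]

lemma exists_of_mem_sobolev {X : Distr N 𝕜} {s : ℝ} (hX : X ∈ sobolev N 𝕜 s) {k : ℕ}
    (hk : 1 < s / 2 + k) :
    ∃ u : FlatL2 N 𝕜, ∀ φ, mulSqrt X φ =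
      ⟪embL2 N 𝕜 ((oneAddNumber N 𝕜 ^ k) (testToSchwartz 𝕜 φ)),
        multiplier N 𝕜 (fun n => (1 + n : ℝ) ^ (-(s / 2) - k)) u⟫_𝕜 := by
  obtain ⟨f, g, hfg, hg, hlim⟩ := hX
  obtain ⟨g', hg'⟩ := cauchySeq_tendsto_of_complete hg
  refine ⟨flat N 𝕜 g', fun φ => tendsto_nhds_unique (hlim (mulSqrtTest N φ)) ?_⟩
  simp only [integral_smul_eq_inner, divSqrtTest_mulSqrtTest,
    (hfg _).inner_eq_inner_multiplier hk]
  exact tendsto_const_nhds.inner ((multiplier N 𝕜 _).continuous.tendsto _ |>.comp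
    ((flat N 𝕜).continuous.tendsto _ |>.comp hg'))

lemma hermiteProj_multiplier {m : ℕ → ℝ} (hm : Summable m) (n : ℕ) (u : FlatL2 N 𝕜) :
    hermiteProj N 𝕜 n (multiplier N 𝕜 m u) = (m n : 𝕜) • hermiteProj N 𝕜 n u := by
  refine ext_inner_hermiteSpace fun k w hw => ?_
  rw [inner_smul_right]
  obtain rfl | hkn := eq_or_ne k n
  · rw [inner_hermiteProj hw, inner_hermiteProj hw, inner_multiplier hm _ hw]
  · rw [inner_hermiteProj_of_ne hkn hw, inner_hermiteProj_of_ne hkn hw, mul_zero]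

lemma exists_hermiteProj_le_of_mem_sobolev {X : Distr N 𝕜} {M : ℕ}
    (hX : X ∈ sobolev N 𝕜 (2 * (M + 2))) :
    ∃ u : FlatL2 N 𝕜, (∀ φ, mulSqrt X φ = ⟪embL2 N 𝕜 (testToSchwartz 𝕜 φ), u⟫_𝕜) ∧
      ∃ C : ℝ, ∀ n : ℕ, (1 + n : ℝ) ^ M * ‖hermiteProj N 𝕜 n u‖ ≤ C := by
  obtain ⟨u, hu⟩ := exists_of_mem_sobolev hX (k := 0) (by
    push_cast
    linarith [(Nat.cast_nonneg M : (0 : ℝ) ≤ M)])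
  refine ⟨_, hu, ‖u‖, fun n => ?_⟩
  have hweight : (1 + n : ℝ) ^ M * (1 + n : ℝ) ^ (-(2 * ((M : ℝ) + 2) / 2) - (0 : ℕ)) ≤ 1 := by
    rw [← Real.rpow_natCast, ← Real.rpow_add (by positivity)]
    refine Real.rpow_le_one_of_one_le_of_nonpos (by simp) ?_
    push_cast
    linarith
  rw [hermiteProj_multiplier (summable_one_add_rpow (by
      push_cast
      linarith [(Nat.cast_nonneg M : (0 : ℝ) ≤ M)])), norm_smul, RCLike.norm_ofReal,
    abs_of_nonneg (by positivity), ← mul_assoc]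
  exact (mul_le_of_le_one_left (norm_nonneg _) hweight).trans (norm_hermiteProj_le n u)

lemma isSchwartz_of_mem_sobolevTop {X : Distr N 𝕜} (hX : X ∈ sobolevTop N 𝕜) :
    IsSchwartz (mulSqrt X) := by
  rw [sobolevTop, Set.mem_iInter₂] at hX
  choose u hu hbound using fun M : ℕ =>
    exists_hermiteProj_le_of_mem_sobolev (hX (2 * (M + 2)) (by positivity))
  have hconst : ∀ M, u M = u 0 := fun M =>
    ext_inner_hermiteSpace fun n w _ =>
      inner_eq_of_forall_test (embL2 N 𝕜) (embL2 N 𝕜) (fun φ => by rw [← hu M, ← hu 0]) w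
  obtain ⟨ψ, hψ, -⟩ := exists_hasSum_hermiteComp (u := u 0) fun M => hconst M ▸ hbound M
  exact ⟨ψ, fun φ => by rw [hu 0, ← hψ, inner_testToSchwartz_embL2]⟩

/-- Complex conjugation on the Schwartz space. -/
def conjSchwartz (N : ℕ) (𝕜 : Type*) [RCLike 𝕜] : 𝓢(Space N, 𝕜) →L[ℝ] 𝓢(Space N, 𝕜) :=
  postcompCLM (RCLike.conjCLE (K := 𝕜)).toContinuousLinearMap

lemma conjSchwartz_apply (ψ : 𝓢(Space N, 𝕜)) (x : Space N) :
    conjSchwartz N 𝕜 ψ x = conj (ψ x) := rfl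

/-- The complex conjugate `ψ ↦ conj (U (conj ψ))` of a tempered distribution `U`. -/
def conjFunctional (U : 𝓢(Space N, 𝕜) →L[𝕜] 𝕜) : 𝓢(Space N, 𝕜) →L[𝕜] 𝕜 where
  toFun ψ := conj (U (conjSchwartz N 𝕜 ψ))
  map_add' φ ψ := by simp only [map_add]
  map_smul' c ψ := by
    have hsmul : conjSchwartz N 𝕜 (c • ψ) = conj c • conjSchwartz N 𝕜 ψ := by
      ext x
      simp [conjSchwartz_apply]
    simp [hsmul]
  cont := RCLike.continuous_conj.comp (U.continuous.comp (conjSchwartz N 𝕜).continuous)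

lemma conjFunctional_testToSchwartz (U : 𝓢(Space N, 𝕜) →L[𝕜] 𝕜) (φ : Test N) :
    conjFunctional U (testToSchwartz 𝕜 φ) = conj (U (testToSchwartz 𝕜 φ)) := by
  change conj (U (conjSchwartz N 𝕜 (testToSchwartz 𝕜 φ))) = _
  congr 2
  ext x
  rw [conjSchwartz_apply, testToSchwartz_apply, RCLike.conj_ofReal]

lemma isTempered_iff_exists_conj {T : Test N →ₗ[ℝ] 𝕜} : IsTempered T ↔
    ∃ V : 𝓢(Space N, 𝕜) →L[𝕜] 𝕜, ∀ φ : Test N, T φ = conj (V (testToSchwartz 𝕜 φ)) := by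
  constructor
  · rintro ⟨U, hU⟩
    exact ⟨conjFunctional U, fun φ => by
      rw [hU, conjFunctional_testToSchwartz, RCLike.conj_conj]⟩
  · rintro ⟨V, hV⟩
    exact ⟨conjFunctional V, fun φ => by rw [hV, conjFunctional_testToSchwartz]⟩

lemma polyBounded_of_continuous {q : Seminorm 𝕜 𝓢(Space N, 𝕜)} (hq : Continuous q) :
    PolyBounded q := by
  obtain ⟨s, C, -, hqC⟩ := Seminorm.bound_of_continuous
    (schwartz_withSeminorms 𝕜 (Space N) 𝕜) q hq
  obtain ⟨C', M, hC', hb⟩ : PolyBounded (∑ i ∈ s, schwartzSeminormFamily 𝕜 (Space N) 𝕜 i) :=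
    PolyBounded.sum fun i _ => polyBounded_seminorm i.1 i.2
  refine ⟨C * C', M, by positivity, fun n w hw => ?_⟩
  calc q w ≤ C * (s.sup (schwartzSeminormFamily 𝕜 (Space N) 𝕜)) w := hqC w
    _ ≤ C * (∑ i ∈ s, schwartzSeminormFamily 𝕜 (Space N) 𝕜 i) w := by
        gcongr
        exact Seminorm.finset_sup_le_sum _ s w
    _ ≤ C * (C' * (1 + n) ^ M * ‖embL2 N 𝕜 w‖) := by gcongr; exact hb n w hw
    _ = _ := by ring

lemma exists_riesz_hermiteSpace (V : 𝓢(Space N, 𝕜) →L[𝕜] 𝕜) (n : ℕ) :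
    ∃ b ∈ hermiteSpace N 𝕜 n, ∀ w ∈ hermiteSpace N 𝕜 n,
      V w = ⟪embL2 N 𝕜 b, embL2 N 𝕜 w⟫_𝕜 := by
  let e := Submodule.equivMapOfInjective (embL2 N 𝕜).toLinearMap embL2_injective
    (hermiteSpace N 𝕜 n)
  let l := LinearMap.toContinuousLinearMap
    (V.toLinearMap ∘ₗ (hermiteSpace N 𝕜 n).subtype ∘ₗ e.symm.toLinearMap)
  have : CompleteSpace ((hermiteSpace N 𝕜 n).map (embL2 N 𝕜).toLinearMap) :=
    FiniteDimensional.complete 𝕜 _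
  obtain ⟨b, hb, hbl⟩ := ((InnerProductSpace.toDual 𝕜 _).symm l).2
  refine ⟨b, hb, fun w hw => ?_⟩
  have hriesz : ⟪(InnerProductSpace.toDual 𝕜 _).symm l, e ⟨w, hw⟩⟫_𝕜 = l (e ⟨w, hw⟩) :=
    InnerProductSpace.toDual_symm_apply
  have hl : l (e ⟨w, hw⟩) = V w := by
    change V ((e.symm (e ⟨w, hw⟩) : hermiteSpace N 𝕜 n) : 𝓢(Space N, 𝕜)) = V w
    rw [LinearEquiv.symm_apply_apply]
  rw [← hl, ← hriesz, Submodule.coe_inner, ← hbl]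
  rfl

lemma exists_riesz_hermiteSpace_le (V : 𝓢(Space N, 𝕜) →L[𝕜] 𝕜) :
    ∃ b : ℕ → 𝓢(Space N, 𝕜), (∀ n, b n ∈ hermiteSpace N 𝕜 n) ∧
      (∀ n, ∀ w ∈ hermiteSpace N 𝕜 n, V w = ⟪embL2 N 𝕜 (b n), embL2 N 𝕜 w⟫_𝕜) ∧
      ∃ (C : ℝ) (M : ℕ), ∀ n : ℕ, ‖embL2 N 𝕜 (b n)‖ ≤ C * (1 + n) ^ M := by
  choose b hb hbV using exists_riesz_hermiteSpace V
  obtain ⟨C, M, hC, hV⟩ := polyBounded_of_continuous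
    (q := (normSeminorm 𝕜 𝕜).comp V.toLinearMap) (continuous_norm.comp V.continuous)
  refine ⟨b, hb, hbV, C, M, fun n => ?_⟩
  have hsq : ‖embL2 N 𝕜 (b n)‖ * ‖embL2 N 𝕜 (b n)‖ ≤
      C * (1 + n) ^ M * ‖embL2 N 𝕜 (b n)‖ := by
    refine le_of_eq_of_le ?_ (hV n (b n) (hb n))
    change _ = ‖V (b n)‖
    rw [hbV n _ (hb n), inner_self_eq_norm_sq_to_K, norm_pow, RCLike.norm_ofReal, abs_norm, sq]
  obtain hzero | hpos := (norm_nonneg (embL2 N 𝕜 (b n))).eq_or_lt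
  · rw [← hzero]
    positivity
  · exact le_of_mul_le_mul_right hsq hpos

lemma mem_sobolevBot_of_isTempered {X : Distr N 𝕜} (hX : IsTempered (mulSqrt X)) :
    X ∈ sobolevBot N 𝕜 := by
  obtain ⟨V, hV⟩ := isTempered_iff_exists_conj.1 hX
  obtain ⟨b, hb, hbV, C, M, hbound⟩ := exists_riesz_hermiteSpace_le V
  rw [sobolevBot, Set.mem_iUnion₂]
  refine ⟨-(2 * (M + 2)), by linarith [(Nat.cast_nonneg M : (0 : ℝ) ≤ M)],
    mem_sobolev_of_hasSum hb (summable_of_one_add_pow_mul_le (C := C) (fun n => by positivity)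
      fun n => ?_) fun φ => ?_⟩
  · have hexp : -(2 * ((M : ℝ) + 2)) / 2 = -((M + 2 : ℕ) : ℝ) := by push_cast; ring
    rw [hexp, Real.rpow_neg (by positivity), Real.rpow_natCast]
    calc _ ≤ (1 + n : ℝ) ^ 2 * (((1 + n : ℝ) ^ (M + 2))⁻¹ * (C * (1 + n) ^ M)) := by
          gcongr
          exact hbound n
      _ = C := by
          rw [pow_add]
          field_simp
  · have hinner : ∀ n, ⟪embL2 N 𝕜 (testToSchwartz 𝕜 φ), embL2 N 𝕜 (b n)⟫_𝕜 =
        conj (V (hermiteComp n (embL2 N 𝕜 (testToSchwartz 𝕜 φ)))) := fun n => by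
      rw [hbV n _ (hermiteComp_mem_hermiteSpace n _), embL2_hermiteComp, inner_hermiteProj (hb n),
        inner_conj_symm]
    simp only [hinner, hV]
    exact ((hasSum_hermiteComp _).mapL V).star

lemma isTempered_of_mem_sobolevBot {X : Distr N 𝕜} (hX : X ∈ sobolevBot N 𝕜) :
    IsTempered (mulSqrt X) := by
  rw [sobolevBot, Set.mem_iUnion₂] at hX
  obtain ⟨s, -, hXs⟩ := hX
  obtain ⟨k, hk⟩ := exists_nat_gt (1 - s / 2)
  obtain ⟨u, hu⟩ := exists_of_mem_sobolev hXs (k := k) (by linarith)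
  refine isTempered_iff_exists_conj.2
    ⟨(innerSL 𝕜 (multiplier N 𝕜 (fun n => (1 + n : ℝ) ^ (-(s / 2) - k)) u)).comp
      ((embL2 N 𝕜).comp (oneAddNumber N 𝕜 ^ k)), fun φ => ?_⟩
  rw [hu]
  exact (inner_conj_symm _ _).symm

end Characterization

end DiscreteWiener

end

theorem proposition2p2 (𝕜 : Type*) [RCLike 𝕜] (N : ℕ) (X : DiscreteWiener.Distr N 𝕜) :
    (DiscreteWiener.IsSchwartz (DiscreteWiener.mulSqrt X) ↔
      X ∈ DiscreteWiener.sobolevTop N 𝕜) ∧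
    (DiscreteWiener.IsTempered (DiscreteWiener.mulSqrt X) ↔
      X ∈ DiscreteWiener.sobolevBot N 𝕜) :=
  ⟨⟨fun h => Set.mem_iInter₂.2 fun s _ => DiscreteWiener.mem_sobolev_of_isSchwartz h s,
    DiscreteWiener.isSchwartz_of_mem_sobolevTop⟩,
    ⟨DiscreteWiener.mem_sobolevBot_of_isTempered, DiscreteWiener.isTempered_of_mem_sobolevBot⟩⟩
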